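/- Model. Let $n,k\ge 1$. A $k$-OBDD on the variables $x_1,\dots,x_n$ is an oblivious leveled branching program with $kn$ levels of inner nodes, followed by a level of sinks, which reads the variables $k$ times, each time in the same order $\pi$ (any permutation of $\{1,\dots,n\}$, chosen by the program): all nodes of the $i$-th level of each of the $k$ layers test $x_{\pi(i)}$, and edges lead only from a level to the next one. The first level contains the source $s$, the last level contains the accepting sink $t$. The width is the maximal number of nodes of a level, the level of the sinks not counted. In a (deterministic) $k$-OBDD every inner node has exactly one outgoing edge for each value of the tested variable; it computes $f:\{0,1\}^n\to\{0,1\}$ if for every $\sigma$ the path from $s$ that is consistent with $\sigma$ ends in $t$ if and only if $f(\sigma)=1$. In a $k$-NOBDD a node may have any number of outgoing edges for each value; it computes $f$ if for every $\sigma$ some path from $s$ to $t$ is consistent with $\sigma$ if and only if $f(\sigma)=1$. In a $k$-POBDD the next node is chosen at random, with probabilities that depend on the current node and on the value of the tested variable; it computes $f$ with error at most $\frac12-\varepsilon$ if on every input the right answer (accepting, that is, ending in $t$, if and only if $f=1$) has probability at least $\frac12+\varepsilon$. For real $W$ let $k\text{-}\mathbf{OBDD}_W$, $k\text{-}\mathbf{NOBDD}_W$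 and $k\text{-}\mathbf{POBDD}^{\varepsilon}_W$ be the sets of the functions $f:\{0,1\}^n\to\{0,1\}$ that are computed by a $k$-OBDD, by a $k$-NOBDD, and by a $k$-POBDD with error at most $\frac12-\varepsilon$, respectively, of width at most $W$. Theorem. Let $n,k,w$ be integers with $k\ge 2$, $w\ge 64$, $$2kw\bigl(2w+\lceil\log_2 k\rceil+\lceil\log_2 2w\rceil\bigr)<n \qquad\text{and}\qquad \frac{\sqrt w}{\log_2 k\,\log_2 w}\ge 1 .$$ Then there is a Boolean function $f:\{0,1\}^n\to\{0,1\}$ such that $$f\in k\text{-}\mathbf{OBDD}_{3w+1},\qquad f\in k\text{-}\mathbf{NOBDD}_{3w+1},\qquad f\in k\text{-}\mathbf{POBDD}^{\varepsilon}_{3w+1}\ \text{ for every }\varepsilon\in(0,\tfrac12],$$ $$f\notin k\text{-}\mathbf{OBDD}_{\lfloor w/16\rfloor-3},\qquad f\notin k\text{-}\mathbf{NOBDD}_{\sqrt w/2},\qquad f\notin k\text{-}\mathbf{POBDD}^{\varepsilon}_{\sqrt w/(\log_2 k\,\log_2 w)}\ \text{ for every }\varepsilon\in(0,\tfrac12].$$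 -/

import Mathlib

/-- Boolean functions of `n` Boolean variables. -/
abbrev BoolFn (n : ℕ) : Type := (Fin n → Bool) → Bool

/-- The bit tested at level `j` (levels are numbered from `0`) by an oblivious leveled program which
reads the `n` input bits layer after layer, in every layer in the same order `π`: the level
`j = t * n + i` with `i < n` is the `i`-th level of layer `t`, and tests the variable `π i`.
(For `n = 0` no bit is ever tested and the value is irrelevant.) -/
def testedBit {n : ℕ} (π : Equiv.Perm (Fin n)) (x : Fin n → Bool) (j : ℕ) : Bool :=
  if h : 0 < n then x (π ⟨j % n, Nat.mod_lt j h⟩) else false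

/-- The common part of all the `k`-layer programs: the order, the number of nodes of each level,
the source and the accepting sink.  The levels `0, …, k * n - 1` are those of the inner nodes; level
`k * n` is the level of the sinks.  (Nothing at levels after `k * n` is ever used.) -/
structure LeveledShape (n k : ℕ) where
  /-- the order in which every layer tests the variables -/
  order : Equiv.Perm (Fin n)
  /-- the number of nodes at each level -/
  size : ℕ → ℕ
  /-- the source node -/
  source : Fin (size 0)
  /-- the accepting sink; all other nodes of the last level are rejecting -/
  sink : Fin (size (k * n))

/-- The width: the maximal number of nodes of a level, the level of the sinks not counted. -/
def LeveledShape.width {n k : ℕ} (P : LeveledShape n k) : ℕ :=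
  (Finset.range (k * n)).sup P.size

/-- Deterministic `k`-OBDDs: a node has exactly two outgoing edges, one for each value of the
tested bit. -/
structure DetProgram (n k : ℕ) extends LeveledShape n k where
  /-- the end of the outgoing edge labelled by the given bit -/
  next : (j : ℕ) → Bool → Fin (size j) → Fin (size (j + 1))

/-- The node that is reached at level `j` on input `x`. -/
def DetProgram.state {n k : ℕ} (P : DetProgram n k) (x : Fin n → Bool) :
    (j : ℕ) → Fin (P.size j)
  | 0 => P.source
  | j + 1 => P.next j (testedBit P.order x j) (P.state x j)

/-- `P` computes `f`: the computation ends in the accepting sink exactly on the ones of `f`. -/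
def DetProgram.Computes {n k : ℕ} (P : DetProgram n k) (f : BoolFn n) : Prop :=
  ∀ x, f x = true ↔ P.state x (k * n) = P.sink

/-- Nondeterministic `k`-OBDDs: arbitrarily many outgoing edges for each value of the
tested bit. -/
structure NondetProgram (n k : ℕ) extends LeveledShape n k where
  /-- there is an edge, labelled by the given bit, between the given nodes -/
  edge : (j : ℕ) → Bool → Fin (size j) → Fin (size (j + 1)) → Prop

/-- The nodes of level `j` to which a path from the source leads all whose edges are consistent
with `x`. -/
def NondetProgram.reachable {n k : ℕ} (P : NondetProgram n k) (x : Fin n → Bool) :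
    (j : ℕ) → Set (Fin (P.size j))
  | 0 => {P.source}
  | j + 1 => {v | ∃ u ∈ P.reachable x j, P.edge j (testedBit P.order x j) u v}

/-- `P` computes `f`: there is an accepting path exactly on the ones of `f`. -/
def NondetProgram.Computes {n k : ℕ} (P : NondetProgram n k) (f : BoolFn n) : Prop :=
  ∀ x, f x = true ↔ P.sink ∈ P.reachable x (k * n)

/-- Probabilistic `k`-OBDDs: for each value of the tested bit, the next node is chosen at random
with given probabilities. -/
structure ProbProgram (n k : ℕ) extends LeveledShape n k where
  /-- the probability of going from the first to the second node when the given bit is read -/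
  prob : (j : ℕ) → Bool → Fin (size j) → Fin (size (j + 1)) → ℝ
  prob_nonneg : ∀ j b u v, 0 ≤ prob j b u v
  prob_sum : ∀ j b u, ∑ v, prob j b u v = 1

/-- The probability of being at the given node of level `j` on input `x`. -/
def ProbProgram.dist {n k : ℕ} (P : ProbProgram n k) (x : Fin n → Bool) :
    (j : ℕ) → Fin (P.size j) → ℝ
  | 0 => fun v => if v = P.source then 1 else 0
  | j + 1 => fun v => ∑ u, P.dist x j u * P.prob j (testedBit P.order x j) u v

/-- The probability that `P` accepts the input `x`. -/
def ProbProgram.acceptProb {n k : ℕ} (P : ProbProgram n k) (x : Fin n → Bool) : ℝ :=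
  P.dist x (k * n) P.sink

/-- `P` computes `f` with error at most `1 / 2 - ε`: on every input the probability of the right
answer is at least `1 / 2 + ε`. -/
def ProbProgram.Computes {n k : ℕ} (P : ProbProgram n k) (ε : ℝ) (f : BoolFn n) : Prop :=
  ∀ x, 1 / 2 + ε ≤ if f x = true then P.acceptProb x else 1 - P.acceptProb x

/-- `k`-OBDD with width (at most) `W`: the functions computed by deterministic `k`-OBDDs of
width at most `W`. -/
def kOBDD (n k : ℕ) (W : ℝ) : Set (BoolFn n) :=
  {f | ∃ P : DetProgram n k, (P.width : ℝ) ≤ W ∧ P.Computes f}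

/-- `k`-NOBDD with width (at most) `W`. -/
def kNOBDD (n k : ℕ) (W : ℝ) : Set (BoolFn n) :=
  {f | ∃ P : NondetProgram n k, (P.width : ℝ) ≤ W ∧ P.Computes f}

/-- `k`-POBDD with width (at most) `W` and error at most `1 / 2 - ε`. -/
def kPOBDD (n k : ℕ) (ε W : ℝ) : Set (BoolFn n) :=
  {f | ∃ P : ProbProgram n k, (P.width : ℝ) ≤ W ∧ P.Computes ε f}

/-! The witness `registerFn` is evaluated by a machine with `p` one-bit registers, a parity bit and
a flag. It has `2 ^ p * 4 ≤ 3 * w + 1` states, and reading the variables in their natural order it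
needs `k` passes. This gives the deterministic upper bound, and the other two follow because a
deterministic program is also a nondeterministic and a probabilistic one (`registerFn_mem_kOBDD`).
The input is a sequence of blocks. A block contains one value bit and the code of a task: in a
certain layer, either store the value in a register, or multiply it by a register and add the
product to the parity. For the lower bounds, fix an order `π`. A median argument (`exists_cut`)
finds a cut of `π` and two groups of `m = (2 * k - 1) * p` blocks, one whose values are tested
before the cut and one whose values are tested after it; all blocks of one group precede those of
the other in the input. Once the tasks are fixed, two players owning the value bits of the two
groups exchange `2 * k - 1` messages of `p` bits through the registers. The receiver multiplies each
bit of a message by a bit of his own, so the function becomes the inner product modulo 2 of two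
vectors of `m` bits (`splitsHard_registerFn`). Its sign matrix has `2 ^ m` orthogonal rows. A
program of width `d` and `k` layers crosses the cut `2 * k - 1` times after its first segment. Hence
its acceptance probabilities, or its numbers of accepting paths, form a matrix of rank at most `d ^
(2 * k - 1)` (`SplitAt.hasRankLE`). In the deterministic case an affine change turns this matrix
into the sign matrix, which has full rank `2 ^ m`. In the other two cases the matrix has only the
right signs after subtraction of 1/2, for any positive `ε`, and Forster's theorem bounds `2 ^ m` by
the square of the rank. Comparing `d ^ (2 * k - 1)` with `2 ^ m = (2 ^ p) ^ (2 * k - 1)` concludes.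
-/

section Forster
-- Determinants and images of vectors in general position
open scoped Matrix

/-- A crude form of Hadamard's inequality. -/
theorem exists_det_sq_le_prod_rows (r : ℕ) :
    ∃ C : ℝ, 0 < C ∧ ∀ M : Matrix (Fin r) (Fin r) ℝ, M.det ^ 2 ≤ C * ∏ i, (M i ⬝ᵥ M i) := by
  refine ⟨(r.factorial : ℝ) ^ 2, by positivity, fun M => ?_⟩
  have hnn : ∀ i, 0 ≤ M i ⬝ᵥ M i := fun i => by
    simp only [dotProduct]; exact Finset.sum_nonneg fun j _ => mul_self_nonneg _
  have hentry : ∀ i j, |M i j| ≤ Real.sqrt (M i ⬝ᵥ M i) := fun i j => by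
    apply Real.le_sqrt_of_sq_le
    rw [sq_abs, sq]
    exact Finset.single_le_sum (f := fun j => M i j * M i j) (fun j _ => mul_self_nonneg _)
      (Finset.mem_univ j)
  have habs : |M.det| ≤ r.factorial * ∏ i, Real.sqrt (M i ⬝ᵥ M i) := by
    rw [Matrix.det_apply]
    refine (Finset.abs_sum_le_sum_abs _ _).trans ?_
    calc _ ≤ ∑ _σ : Equiv.Perm (Fin r), ∏ i, Real.sqrt (M i ⬝ᵥ M i) := by
            refine Finset.sum_le_sum fun σ _ => ?_
            have : |Equiv.Perm.sign σ • ∏ i, M (σ i) i| = ∏ i, |M (σ i) i| := by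
              rw [← Finset.abs_prod]
              rcases Int.units_eq_one_or (Equiv.Perm.sign σ) with h | h <;> rw [h] <;> simp
            rw [this, ← Equiv.prod_comp σ (fun i => Real.sqrt (M i ⬝ᵥ M i))]
            exact Finset.prod_le_prod (fun _ _ => abs_nonneg _) fun i _ => hentry _ _
      _ = _ := by simp [Fintype.card_perm]
  calc M.det ^ 2 = |M.det| ^ 2 := (sq_abs _).symm
    _ ≤ (r.factorial * ∏ i, Real.sqrt (M i ⬝ᵥ M i)) ^ 2 := by gcongr
    _ = _ := by
      rw [mul_pow, ← Finset.prod_pow]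
      congr 1
      exact Finset.prod_congr rfl fun i _ => Real.sq_sqrt (hnn i)

variable {X : Type*} [Fintype X] {r : ℕ}

/-- Any `r` members of the family `u` are linearly independent. -/
def InGeneralPosition (u : X → Fin r → ℝ) : Prop :=
  ∀ e : Fin r ↪ X, (Matrix.of fun i => u (e i)).det ≠ 0

/-- The square of the length of the image of `v` under `A`. -/
def imageSq (A : Matrix (Fin r) (Fin r) ℝ) (v : Fin r → ℝ) : ℝ := (A *ᵥ v) ⬝ᵥ (A *ᵥ v)

theorem dotProduct_self_nonneg_real (v : Fin r → ℝ) : 0 ≤ v ⬝ᵥ v :=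
  Finset.sum_nonneg fun _ _ => mul_self_nonneg _

theorem imageSq_nonneg (A : Matrix (Fin r) (Fin r) ℝ) (v : Fin r → ℝ) : 0 ≤ imageSq A v :=
  dotProduct_self_nonneg_real _

theorem continuous_imageSq (v : Fin r → ℝ) :
    Continuous fun A : Matrix (Fin r) (Fin r) ℝ => imageSq A v := by
  unfold imageSq
  fun_prop

theorem imageSq_pos {A : Matrix (Fin r) (Fin r) ℝ} (hA : A.det ≠ 0) {v : Fin r → ℝ} (hv : v ≠ 0) :
    0 < imageSq A v := by
  refine lt_of_le_of_ne (imageSq_nonneg A v) fun h => hv ?_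
  exact Matrix.eq_zero_of_mulVec_eq_zero hA (dotProduct_self_eq_zero.1 h.symm)

theorem imageSq_smul (t : ℝ) (A : Matrix (Fin r) (Fin r) ℝ) (v : Fin r → ℝ) :
    imageSq (t • A) v = t ^ 2 * imageSq A v := by
  simp [imageSq, Matrix.smul_mulVec]
  ring

/-- The unit sphere of the space of matrices. -/
def matrixSphere (r : ℕ) : Set (Matrix (Fin r) (Fin r) ℝ) := {A | ∑ i, ∑ j, A i j ^ 2 = 1}

theorem isCompact_matrixSphere (r : ℕ) : IsCompact (matrixSphere r) := by
  have hc : IsCompact (Set.univ.pi fun _ : Fin r => Set.univ.pi fun _ : Fin r =>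
      Set.Icc (-1 : ℝ) 1) :=
    isCompact_univ_pi fun _ => isCompact_univ_pi fun _ => isCompact_Icc
  refine IsCompact.of_isClosed_subset (t := matrixSphere r) hc ?_ ?_
  · exact isClosed_eq (by fun_prop) continuous_const
  · intro A hA i _ j _
    have h1 : A i j ^ 2 ≤ 1 := by
      rw [← show _ = _ from hA]
      refine le_trans ?_ (Finset.single_le_sum (f := fun i => ∑ j, A i j ^ 2)
        (fun i _ => Finset.sum_nonneg fun j _ => sq_nonneg _) (Finset.mem_univ i))
      exact Finset.single_le_sum (f := fun j => A i j ^ 2) (fun j _ => sq_nonneg _)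
        (Finset.mem_univ j)
    exact abs_le.1 (abs_le_one_iff_mul_self_le_one.2 (by rwa [← sq]))

/-- A matrix that kills `r` independent vectors is zero, so each sum is positive on the sphere.
Compactness and the finiteness of the set of embeddings make the bound uniform. -/
theorem exists_le_sum_imageSq {u : X → Fin r → ℝ} (hu : InGeneralPosition u) :
    ∃ c : ℝ, 0 < c ∧ ∀ e : Fin r ↪ X, ∀ A ∈ matrixSphere r, c ≤ ∑ i, imageSq A (u (e i)) := by
  classical
  have hone : ∀ e : Fin r ↪ X, ∃ c : ℝ, 0 < c ∧ ∀ A ∈ matrixSphere r,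
      c ≤ ∑ i, imageSq A (u (e i)) := by
    intro e
    rcases (matrixSphere r).eq_empty_or_nonempty with h | h
    · exact ⟨1, one_pos, by simp [h]⟩
    obtain ⟨A, hA, hmin⟩ := (isCompact_matrixSphere r).exists_isMinOn h
      (f := fun A => ∑ i, imageSq A (u (e i)))
      (continuous_finsetSum _ fun i _ => continuous_imageSq _).continuousOn
    refine ⟨_, ?_, fun B hB => hmin hB⟩
    refine lt_of_le_of_ne (Finset.sum_nonneg fun i _ => imageSq_nonneg _ _) fun h0 => ?_
    have hz := (Finset.sum_eq_zero_iff_of_nonneg fun i _ => imageSq_nonneg A (u (e i))).1 h0.symm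
    have hprod : (Matrix.of fun i => u (e i)) * Aᵀ = 0 := by
      ext i j
      have := dotProduct_self_eq_zero.1 (hz i (Finset.mem_univ i))
      have := congrFun this j
      simpa [Matrix.mul_apply, Matrix.mulVec, dotProduct, mul_comm] using this
    have hA0 : Aᵀ = 0 := by
      have := congrArg (fun M => (Matrix.of fun i => u (e i))⁻¹ * M) hprod
      simpa [← Matrix.mul_assoc, Matrix.nonsing_inv_mul _ (hu e).isUnit] using this
    have : A = 0 := by simpa using hA0
    have h1 : ∑ i, ∑ j, A i j ^ 2 = 1 := hA
    simp [this] at h1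
  choose c hc hle using hone
  rcases isEmpty_or_nonempty (Fin r ↪ X) with h | h
  · exact ⟨1, one_pos, fun e => (h.false e).elim⟩
  · obtain ⟨e₀, he₀⟩ := Finite.exists_min c
    exact ⟨c e₀, hc e₀, fun e A hA => (he₀ e).trans (hle e A hA)⟩

/-- By the previous bound at most `r` vectors have a short image. Extend them to a set of exactly
`r` vectors: their product is controlled by the determinant through Hadamard's inequality, and every
other factor is at least a constant. -/
theorem exists_det_sq_le_prod_imageSq {u : X → Fin r → ℝ} (hu : InGeneralPosition u)
    (hr : 0 < r) (hX : r ≤ Fintype.card X) :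
    ∃ c : ℝ, 0 < c ∧ ∀ A ∈ matrixSphere r, c * A.det ^ 2 ≤ ∏ x, imageSq A (u x) := by
  classical
  obtain ⟨C, hC, hdet⟩ := exists_det_sq_le_prod_rows r
  obtain ⟨c₁, hc₁, hsum⟩ := exists_le_sum_imageSq hu
  have hne : Nonempty (Fin r ↪ X) := Function.Embedding.nonempty_of_card_le (by simpa using hX)
  obtain ⟨e₀, he₀⟩ := Finite.exists_min
    fun e : Fin r ↪ X => (Matrix.of fun i => u (e i)).det ^ 2
  set δ := (Matrix.of fun i => u (e₀ i)).det ^ 2 with hδ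
  have hδ0 : 0 < δ := sq_pos_of_ne_zero (hu e₀)
  set b := c₁ / r with hb
  have hb0 : 0 < b := by positivity
  refine ⟨δ / C * b ^ (Fintype.card X - r), by positivity, fun A hA => ?_⟩
  set T := Finset.univ.filter fun x => imageSq A (u x) < b with hT
  have hTr : T.card ≤ r := by
    by_contra! hlt
    obtain ⟨S, hST, hS⟩ := Finset.exists_subset_card_eq hlt.le
    let e : Fin r ↪ X := (S.equivFinOfCardEq hS).symm.toEmbedding.trans
      (Function.Embedding.subtype _)
    have : ∑ i, imageSq A (u (e i)) < ∑ _i : Fin r, b := by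
      refine Finset.sum_lt_sum_of_nonempty ⟨⟨0, hr⟩, Finset.mem_univ _⟩ fun i _ => ?_
      exact (Finset.mem_filter.1 (hST ((S.equivFinOfCardEq hS).symm i).2)).2
    have h2 := hsum e A hA
    rw [Finset.sum_const, Finset.card_univ, Fintype.card_fin, nsmul_eq_mul, hb,
      mul_div_cancel₀ _ (by positivity)] at this
    linarith
  obtain ⟨S, hTS, -, hS⟩ := Finset.exists_subsuperset_card_eq (Finset.subset_univ T) hTr
    (by simpa using hX)
  let e : Fin r ↪ X := (S.equivFinOfCardEq hS).symm.toEmbedding.trans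
      (Function.Embedding.subtype _)
  have hprodS : ∏ x ∈ S, imageSq A (u x) = ∏ i, imageSq A (u (e i)) := by
    rw [← Finset.prod_coe_sort S fun x => imageSq A (u x)]
    exact (Equiv.prod_comp (S.equivFinOfCardEq hS).symm fun x : S => imageSq A (u x)).symm
  have h1 : δ / C * A.det ^ 2 ≤ ∏ x ∈ S, imageSq A (u x) := by
    have h := hdet ((Matrix.of fun i => u (e i)) * Aᵀ)
    have hrow : ∀ i, ((Matrix.of fun i => u (e i)) * Aᵀ) i = A *ᵥ u (e i) := fun i => by
      ext j
      simp [Matrix.mul_apply, Matrix.mulVec, dotProduct, mul_comm]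
    simp only [hrow] at h
    rw [Matrix.det_mul, Matrix.det_transpose, mul_pow] at h
    rw [hprodS, div_mul_eq_mul_div, div_le_iff₀ hC, mul_comm _ C]
    exact (mul_le_mul_of_nonneg_right (he₀ e) (sq_nonneg _)).trans h
  have h2 : b ^ (Fintype.card X - r) ≤ ∏ x ∈ Sᶜ, imageSq A (u x) := by
    have : Fintype.card X - r = Sᶜ.card := by rw [Finset.card_compl, hS]
    rw [this, ← Finset.prod_const]
    refine Finset.prod_le_prod (fun _ _ => hb0.le) fun x hx => ?_
    by_contra! hlt
    exact Finset.mem_compl.1 hx (hTS (Finset.mem_filter.2 ⟨Finset.mem_univ _, hlt⟩))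
  rw [← Finset.prod_mul_prod_compl S]
  calc _ = δ / C * A.det ^ 2 * b ^ (Fintype.card X - r) := by ring
    _ ≤ _ := mul_le_mul h1 h2 (by positivity)
      (Finset.prod_nonneg fun _ _ => imageSq_nonneg _ _)

end Forster

/-! ### Forster's potential and isotropic position -/

section Forster
open scoped Matrix
variable {X : Type*} [Fintype X] {r : ℕ}

/-- A scale invariant function on the regular matrices, the minimizers of which put the directions
of the vectors `u x` into isotropic position. -/
noncomputable def forsterPotential (u : X → Fin r → ℝ) (A : Matrix (Fin r) (Fin r) ℝ) : ℝ :=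
  (∏ x, imageSq A (u x)) ^ r / (A.det ^ 2) ^ Fintype.card X

theorem forsterPotential_smul (u : X → Fin r → ℝ) {t : ℝ} (ht : t ≠ 0)
    (A : Matrix (Fin r) (Fin r) ℝ) : forsterPotential u (t • A) = forsterPotential u A := by
  unfold forsterPotential
  simp only [imageSq_smul, Finset.prod_mul_distrib, Finset.prod_const, Finset.card_univ,
    Matrix.det_smul, Fintype.card_fin]
  have h1 : ((t ^ 2) ^ Fintype.card X * ∏ x, imageSq A (u x)) ^ r =
      (t ^ (2 * Fintype.card X * r)) * (∏ x, imageSq A (u x)) ^ r := by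
    rw [mul_pow, ← pow_mul, ← pow_mul, mul_assoc]
  have h2 : ((t ^ r * A.det) ^ 2) ^ Fintype.card X =
      (t ^ (2 * Fintype.card X * r)) * (A.det ^ 2) ^ Fintype.card X := by
    rw [mul_pow, mul_pow, ← pow_mul, ← pow_mul]
    congr 2
    ring
  rw [h1, h2, mul_div_mul_left _ _ (pow_ne_zero _ ht)]

theorem exists_smul_mem_matrixSphere {A : Matrix (Fin r) (Fin r) ℝ} (hA : A ≠ 0) :
    ∃ t : ℝ, t ≠ 0 ∧ t • A ∈ matrixSphere r := by
  have hnn : 0 ≤ ∑ i, ∑ j, A i j ^ 2 :=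
    Finset.sum_nonneg fun i _ => Finset.sum_nonneg fun j _ => sq_nonneg _
  have hpos : 0 < ∑ i, ∑ j, A i j ^ 2 := by
    refine lt_of_le_of_ne hnn fun h => hA ?_
    ext i j
    have h1 := (Finset.sum_eq_zero_iff_of_nonneg
      fun i _ => Finset.sum_nonneg fun j _ => sq_nonneg (A i j)).1 h.symm i (Finset.mem_univ i)
    have h2 := (Finset.sum_eq_zero_iff_of_nonneg
      fun j _ => sq_nonneg (A i j)).1 h1 j (Finset.mem_univ j)
    simpa using h2
  refine ⟨(Real.sqrt (∑ i, ∑ j, A i j ^ 2))⁻¹, by positivity, ?_⟩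
  simp only [matrixSphere, Set.mem_ofPred_eq, Matrix.smul_apply, smul_eq_mul, mul_pow,
    ← Finset.mul_sum, inv_pow, Real.sq_sqrt hnn]
  exact inv_mul_cancel₀ hpos.ne'

/-- On the unit sphere the potential is at least a constant times a negative power of `det ^ 2`, the
exponent being `r - card X < 0`. So it blows up near singular matrices, and by scale invariance the
minimum may be sought on a compact set of regular ones. -/
theorem exists_forsterPotential_min {u : X → Fin r → ℝ} (hu : InGeneralPosition u)
    (hr : 0 < r) (hX : r < Fintype.card X) :
    ∃ A : Matrix (Fin r) (Fin r) ℝ, A.det ≠ 0 ∧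
      ∀ B : Matrix (Fin r) (Fin r) ℝ, B.det ≠ 0 → forsterPotential u A ≤ forsterPotential u B := by
  obtain ⟨c, hc, hle⟩ := exists_det_sq_le_prod_imageSq hu hr hX.le
  have : Nonempty (Fin r) := ⟨⟨0, hr⟩⟩
  obtain ⟨t, ht, hA₁⟩ := exists_smul_mem_matrixSphere (r := r) (A := 1) one_ne_zero
  set A₁ : Matrix (Fin r) (Fin r) ℝ := t • 1 with hA₁def
  have hdet₁ : A₁.det ≠ 0 := by simp [hA₁def, ht]
  have key : ∀ A ∈ matrixSphere r, A.det ≠ 0 → forsterPotential u A ≤ forsterPotential u A₁ →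
      c ^ r ≤ forsterPotential u A₁ * (A.det ^ 2) ^ (Fintype.card X - r) := by
    intro A hA hdet hAA
    have hd : 0 < A.det ^ 2 := by positivity
    have h1 : (c * A.det ^ 2) ^ r ≤ (∏ x, imageSq A (u x)) ^ r := by
      gcongr
      exact hle A hA
    have h2 : (∏ x, imageSq A (u x)) ^ r =
        forsterPotential u A * (A.det ^ 2) ^ Fintype.card X := by
      unfold forsterPotential
      field_simp
    have h3 : (A.det ^ 2) ^ Fintype.card X =
        (A.det ^ 2) ^ (Fintype.card X - r) * (A.det ^ 2) ^ r := by
      rw [← pow_add, Nat.sub_add_cancel hX.le]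
    rw [h2, mul_pow, h3, ← mul_assoc] at h1
    refine (le_of_mul_le_mul_right h1 (by positivity)).trans ?_
    gcongr
  -- By `key` this closed condition holds for all competitors at least as good as `A₁`, and it keeps
  -- the determinant away from 0.
  set K : Set (Matrix (Fin r) (Fin r) ℝ) := matrixSphere r ∩
    {A | c ^ r ≤ forsterPotential u A₁ * (A.det ^ 2) ^ (Fintype.card X - r)} with hK
  have hdetc : Continuous fun A : Matrix (Fin r) (Fin r) ℝ => A.det :=
    continuous_id.matrix_det
  have hKc : IsCompact K := (isCompact_matrixSphere r).inter_right
    (isClosed_le continuous_const (by fun_prop))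
  have hKdet : ∀ A ∈ K, A.det ≠ 0 := by
    intro A hA h0
    have := hA.2
    simp only [Set.mem_ofPred_eq, h0] at this
    rw [zero_pow two_ne_zero, zero_pow (by omega), mul_zero] at this
    exact absurd (pow_pos hc r) this.not_gt
  have hcont : ContinuousOn (forsterPotential u) K := by
    refine ContinuousOn.div ?_ ?_ fun A hA => by have := hKdet A hA; positivity
    · exact ((continuous_finsetProd _ fun x _ => continuous_imageSq (u x)).pow r).continuousOn
    · exact (by fun_prop : Continuous _).continuousOn
  have hA₁K : A₁ ∈ K := ⟨hA₁, key A₁ hA₁ hdet₁ le_rfl⟩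
  obtain ⟨A, hA, hmin⟩ := hKc.exists_isMinOn ⟨A₁, hA₁K⟩ hcont
  refine ⟨A, hKdet A hA, fun B hB => ?_⟩
  obtain ⟨s, hs, hsB⟩ := exists_smul_mem_matrixSphere (A := B) (by
    rintro rfl
    exact hB (Matrix.det_zero))
  rw [← forsterPotential_smul u hs B]
  by_cases h : forsterPotential u (s • B) ≤ forsterPotential u A₁
  · refine hmin ⟨hsB, key _ hsB ?_ h⟩
    rw [Matrix.det_smul]
    exact mul_ne_zero (pow_ne_zero _ hs) hB
  · exact (hmin hA₁K).trans (not_le.1 h).le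

theorem mulVec_one_add_vecMulVec (t : ℝ) (v w : Fin r → ℝ) :
    (1 + Matrix.vecMulVec (t • v) v) *ᵥ w = w + (t * (v ⬝ᵥ w)) • v := by
  rw [Matrix.add_mulVec, Matrix.one_mulVec, Matrix.vecMulVec_mulVec]
  ext i
  simp
  ring

/-- Regular linear maps put vectors in general position into isotropic position. -/
theorem exists_isotropic {u : X → Fin r → ℝ} (hu : InGeneralPosition u)
    (hr : 0 < r) (hX : r < Fintype.card X) (hu0 : ∀ x, u x ≠ 0) :
    ∃ A : Matrix (Fin r) (Fin r) ℝ, A.det ≠ 0 ∧ ∀ v : Fin r → ℝ,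
      Fintype.card X * (v ⬝ᵥ v) ≤ r * ∑ x, (v ⬝ᵥ (A *ᵥ u x)) ^ 2 / imageSq A (u x) := by
  obtain ⟨A, hA, hmin⟩ := exists_forsterPotential_min hu hr hX
  refine ⟨A, hA, fun v => ?_⟩
  set n := v ⬝ᵥ v with hn
  have hn0 : 0 ≤ n := dotProduct_self_nonneg_real v
  set S := ∑ x, (v ⬝ᵥ (A *ᵥ u x)) ^ 2 / imageSq A (u x) with hS
  have hq : ∀ x, 0 < imageSq A (u x) := fun x => imageSq_pos hA (hu0 x)
  -- First-order optimality of `A`, tested against `(1 + t v vᵀ) A`. The squared determinant gains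
  -- the factor `(1 + t n) ^ 2 = 1 + n s`, and each squared length gains `s` times the squared
  -- component along `v`.
  have key : ∀ t : ℝ, 0 < t → Fintype.card X * n ≤ (1 + n * (2 * t + t ^ 2 * n)) * (r * S) := by
    intro t ht
    set s := 2 * t + t ^ 2 * n with hs
    have hs0 : 0 < s := by positivity
    have hdet : (1 + Matrix.vecMulVec (t • v) v).det = 1 + t * n := by
      rw [Matrix.vecMulVec_eq Unit, Matrix.det_one_add_replicateCol_mul_replicateRow]
      simp [hn]
    have hpot := hmin ((1 + Matrix.vecMulVec (t • v) v) * A) (by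
      rw [Matrix.det_mul, hdet]
      exact mul_ne_zero (by positivity) hA)
    have himg : ∀ x, imageSq ((1 + Matrix.vecMulVec (t • v) v) * A) (u x) =
        imageSq A (u x) * (1 + s * ((v ⬝ᵥ (A *ᵥ u x)) ^ 2 / imageSq A (u x))) := by
      intro x
      have h0 : imageSq ((1 + Matrix.vecMulVec (t • v) v) * A) (u x) =
          imageSq A (u x) + s * (v ⬝ᵥ (A *ᵥ u x)) ^ 2 := by
        unfold imageSq
        rw [← Matrix.mulVec_mulVec, mulVec_one_add_vecMulVec]
        simp only [add_dotProduct, dotProduct_add, smul_dotProduct, dotProduct_smul, smul_eq_mul,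
          dotProduct_comm (A *ᵥ u x) v, ← hn]
        rw [hs]
        ring
      rw [h0, mul_add, mul_one]
      have := (hq x).ne'
      field_simp
    have hle : (1 + n * s) ^ Fintype.card X ≤
        (∏ x, (1 + s * ((v ⬝ᵥ (A *ᵥ u x)) ^ 2 / imageSq A (u x)))) ^ r := by
      unfold forsterPotential at hpot
      simp only [himg, Finset.prod_mul_distrib] at hpot
      rw [Matrix.det_mul, hdet] at hpot
      have hd : ((1 + t * n) * A.det) ^ 2 = (A.det ^ 2) * (1 + n * s) := by rw [hs]; ring
      rw [hd, mul_pow, mul_pow, mul_div_mul_comm] at hpot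
      have hP : 0 < (∏ x, imageSq A (u x)) ^ r / (A.det ^ 2) ^ Fintype.card X := by
        have := Finset.prod_pos fun x (_ : x ∈ Finset.univ) => hq x
        positivity
      have h1 := (le_mul_iff_one_le_right hP).1 hpot
      rwa [one_le_div (by positivity)] at h1
    have hexp : (∏ x, (1 + s * ((v ⬝ᵥ (A *ᵥ u x)) ^ 2 / imageSq A (u x)))) ^ r ≤
        Real.exp (s * (r * S)) := by
      have h1 : ∏ x, (1 + s * ((v ⬝ᵥ (A *ᵥ u x)) ^ 2 / imageSq A (u x))) ≤ Real.exp (s * S) := by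
        rw [hS, Finset.mul_sum, Real.exp_sum]
        refine Finset.prod_le_prod (fun x _ => ?_) fun x _ => ?_
        · have := hq x; positivity
        · rw [add_comm]; exact Real.add_one_le_exp _
      calc _ ≤ Real.exp (s * S) ^ r := by
            gcongr
            exact Finset.prod_nonneg fun x _ => by have := hq x; positivity
        _ = _ := by rw [← Real.exp_nat_mul]; congr 1; ring
    have hpos : 0 < 1 + n * s := by positivity
    have hlog : Fintype.card X * Real.log (1 + n * s) ≤ s * (r * S) := by
      rw [← Real.log_pow]
      exact (Real.log_le_iff_le_exp (by positivity)).2 (hle.trans hexp)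
    have h1 : 1 - (1 + n * s)⁻¹ ≤ Real.log (1 + n * s) := Real.one_sub_inv_le_log_of_pos hpos
    have h2 : 1 - (1 + n * s)⁻¹ = s * (n / (1 + n * s)) := by field_simp; ring
    have h3 : s * (Fintype.card X * (n / (1 + n * s))) ≤ s * (r * S) := by
      refine le_trans ?_ hlog
      rw [h2] at h1
      rw [mul_left_comm]
      gcongr
    have h4 := le_of_mul_le_mul_left h3 hs0
    rw [mul_div_assoc', div_le_iff₀ hpos] at h4
    linarith
  have hlim : Filter.Tendsto (fun t : ℝ => (1 + n * (2 * t + t ^ 2 * n)) * (r * S))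
      (nhdsWithin 0 (Set.Ioi 0)) (nhds ((1 + n * (2 * 0 + 0 ^ 2 * n)) * (r * S))) :=
    (Continuous.tendsto (by fun_prop) 0).mono_left nhdsWithin_le_nhds
  have := ge_of_tendsto hlim (Filter.eventually_of_mem self_mem_nhdsWithin fun t ht => key t ht)
  simpa using this

end Forster

/-! ### Forster's theorem on sign representations -/

section Forster
open scoped Matrix
variable {X Y : Type*} [Fintype X] [Fintype Y] {r : ℕ}

/-- Perturb along a Vandermonde family. Each determinant becomes a polynomial in `t` whose top
coefficient is a nonzero Vandermonde determinant, so only finitely many `t` are bad. -/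
theorem exists_eventually_inGeneralPosition (u : X → Fin r → ℝ) :
    ∃ v : X → Fin r → ℝ, ∀ᶠ t : ℝ in nhdsWithin 0 {0}ᶜ,
      InGeneralPosition fun x => u x + t • v x := by
  classical
  let a : X → ℝ := fun x => (Fintype.equivFin X x : ℕ)
  have ha : Function.Injective a := fun x y h =>
    (Fintype.equivFin X).injective (Fin.ext (Nat.cast_injective h))
  refine ⟨fun x i => a x ^ (i : ℕ), ?_⟩
  unfold InGeneralPosition
  rw [Filter.eventually_all]
  intro e
  set V : Matrix (Fin r) (Fin r) ℝ := Matrix.vandermonde fun i => a (e i) with hV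
  set U : Matrix (Fin r) (Fin r) ℝ := Matrix.of fun i => u (e i) with hU
  have hVdet : V.det ≠ 0 := Matrix.det_vandermonde_ne_zero_iff.2 (ha.comp e.injective)
  set p : Polynomial ℝ :=
    ((Polynomial.X : Polynomial ℝ) • V.map Polynomial.C + U.map Polynomial.C).det with hp
  have hp0 : p ≠ 0 := by
    intro h
    have := Polynomial.coeff_det_X_add_C_card V U
    rw [← hp, h, Polynomial.coeff_zero] at this
    exact hVdet this.symm
  have heval : ∀ t : ℝ, p.eval t = (t • V + U).det := by
    intro t
    rw [hp, ← Polynomial.coe_evalRingHom, RingHom.map_det]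
    congr 1
    ext i j
    simp
    exact mul_comm _ _
  refine Filter.Eventually.filter_mono (nhdsNE_le_cofinite 0) ?_
  refine Filter.Eventually.mono (Set.Finite.compl_mem_cofinite
    (s := {t | p.IsRoot t}) (Polynomial.finite_setOfPred_isRoot hp0)) fun t ht => ?_
  have h1 : p.eval t ≠ 0 := ht
  rw [heval] at h1
  convert h1 using 2
  ext i j
  simp [hU, hV, Matrix.vandermonde, add_comm]

/-- **Forster's theorem**: a matrix with orthogonal rows and entries `1` and `-1` that has the signs
of a matrix of rank `r` has at most `r ^ 2` rows. -/
theorem card_le_sq_of_sign_representation [Nonempty X] [Nonempty Y] {H : X → Y → ℝ}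
    (hsq : ∀ x y, H x y ^ 2 = 1) (horth : ∀ x x', x ≠ x' → ∑ y, H x y * H x' y = 0)
    (α : X → Fin r → ℝ) (β : Y → Fin r → ℝ) (hpos : ∀ x y, 0 < H x y * (α x ⬝ᵥ β y)) :
    Fintype.card X ≤ r ^ 2 := by
  classical
  rcases Nat.eq_zero_or_pos r with rfl | hr
  · obtain ⟨x⟩ := ‹Nonempty X›
    obtain ⟨y⟩ := ‹Nonempty Y›
    simpa using hpos x y
  rcases le_or_gt (Fintype.card X) r with hX | hX
  · exact hX.trans (by nlinarith)
  -- Finitely many strict inequalities survive a small perturbation into general position.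
  obtain ⟨u, hu, hupos⟩ : ∃ u : X → Fin r → ℝ, InGeneralPosition u ∧
      ∀ x y, 0 < H x y * (u x ⬝ᵥ β y) := by
    obtain ⟨v, hv⟩ := exists_eventually_inGeneralPosition α
    have h2 : ∀ᶠ t : ℝ in nhds 0, ∀ x y, 0 < H x y * ((α x + t • v x) ⬝ᵥ β y) := by
      rw [Filter.eventually_all]; intro x
      rw [Filter.eventually_all]; intro y
      have hc : Continuous fun t : ℝ => H x y * ((α x + t • v x) ⬝ᵥ β y) := by fun_prop
      exact (hc.tendsto 0).eventually (lt_mem_nhds (by simpa using hpos x y))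
    obtain ⟨t, ht1, ht2⟩ := (hv.and (h2.filter_mono nhdsWithin_le_nhds)).exists
    exact ⟨_, ht1, ht2⟩
  obtain ⟨y₀⟩ := ‹Nonempty Y›
  have hu0 : ∀ x, u x ≠ 0 := fun x h => by simpa [h] using hupos x y₀
  obtain ⟨A, hA, hiso⟩ := exists_isotropic hu hr hX hu0
  -- The inverse transpose compensates `A`, so all inner products are unchanged.
  set z : Y → Fin r → ℝ := fun y => (A⁻¹)ᵀ *ᵥ β y with hz
  set w : X → Fin r → ℝ := fun x => A *ᵥ u x with hw
  have hwz : ∀ x y, w x ⬝ᵥ z y = u x ⬝ᵥ β y := by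
    intro x y
    rw [hz, hw]
    simp only
    rw [Matrix.mulVec_transpose, dotProduct_comm, ← Matrix.dotProduct_mulVec,
      Matrix.mulVec_mulVec, Matrix.nonsing_inv_mul _ hA.isUnit, Matrix.one_mulVec, dotProduct_comm]
  have hw0 : ∀ x, 0 < w x ⬝ᵥ w x := fun x => imageSq_pos hA (hu0 x)
  have hz0 : ∀ y, 0 < z y ⬝ᵥ z y := fun y => by
    refine lt_of_le_of_ne (dotProduct_self_nonneg_real _) fun h => ?_
    obtain ⟨x⟩ := ‹Nonempty X›
    have h1 := hupos x y
    rw [← hwz, dotProduct_self_eq_zero.1 h.symm] at h1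
    simp at h1
  set w' : X → Fin r → ℝ := fun x => (Real.sqrt (w x ⬝ᵥ w x))⁻¹ • w x with hw'
  set z' : Y → Fin r → ℝ := fun y => (Real.sqrt (z y ⬝ᵥ z y))⁻¹ • z y with hz'
  have hnorm : ∀ v : Fin r → ℝ, 0 < v ⬝ᵥ v →
      ((Real.sqrt (v ⬝ᵥ v))⁻¹ • v) ⬝ᵥ ((Real.sqrt (v ⬝ᵥ v))⁻¹ • v) = 1 := by
    intro v hv
    rw [smul_dotProduct, dotProduct_smul, smul_eq_mul, smul_eq_mul, ← mul_assoc, ← mul_inv,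
      Real.mul_self_sqrt hv.le, inv_mul_cancel₀ hv.ne']
  have hw1 : ∀ x, w' x ⬝ᵥ w' x = 1 := fun x => hnorm _ (hw0 x)
  have hz1 : ∀ y, z' y ⬝ᵥ z' y = 1 := fun y => hnorm _ (hz0 y)
  -- For unit vectors the inner product has modulus at most 1, so its square is at most its modulus,
  -- and the modulus is the product with the sign `H x y`. This is what links isotropy to the sign
  -- matrix.
  have hge : ∀ x y, (z' y ⬝ᵥ w' x) ^ 2 ≤ H x y * (z' y ⬝ᵥ w' x) := by
    intro x y
    have hcs : (z' y ⬝ᵥ w' x) ^ 2 ≤ 1 := by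
      have := Finset.sum_mul_sq_le_sq_mul_sq Finset.univ (z' y) (w' x)
      have h1 := hz1 y
      have h2 := hw1 x
      simp only [dotProduct, ← sq] at h1 h2 ⊢
      rwa [h1, h2, mul_one] at this
    have hp : 0 < H x y * (z' y ⬝ᵥ w' x) := by
      have h3 : z' y ⬝ᵥ w' x =
          (Real.sqrt (z y ⬝ᵥ z y))⁻¹ * (Real.sqrt (w x ⬝ᵥ w x))⁻¹ * (u x ⬝ᵥ β y) := by
        rw [← hwz, hz', hw']
        simp only [smul_dotProduct, dotProduct_smul, smul_eq_mul, dotProduct_comm (w x)]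
        ring
      rw [h3, mul_left_comm]
      have := hw0 x
      have := hz0 y
      exact mul_pos (by positivity) (hupos x y)
    have h4 : (H x y * (z' y ⬝ᵥ w' x)) ^ 2 = (z' y ⬝ᵥ w' x) ^ 2 := by
      rw [mul_pow, hsq, one_mul]
    rw [← h4] at hcs ⊢
    have := abs_le_of_sq_le_sq (a := H x y * (z' y ⬝ᵥ w' x)) (b := 1) (by simpa using hcs) one_pos.le
    nlinarith [(abs_le.1 this).2]
  have hlow : ∀ y, (Fintype.card X : ℝ) / r ≤ ∑ x, H x y * (z' y ⬝ᵥ w' x) := by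
    intro y
    refine le_trans ?_ (Finset.sum_le_sum fun x _ => hge x y)
    rw [div_le_iff₀' (by positivity)]
    have h := hiso (z' y)
    rw [hz1, mul_one] at h
    refine h.trans (le_of_eq ?_)
    congr 1
    refine Finset.sum_congr rfl fun x _ => ?_
    rw [hw']
    simp only [dotProduct_smul, smul_eq_mul, mul_pow, inv_pow]
    rw [Real.sq_sqrt (hw0 x).le, inv_mul_eq_div]
    rfl
  -- Orthogonality of the rows of `H` makes this sum of squares exact; it plays the role of the
  -- spectral norm of `H`.
  have hW : ∑ y, ∑ i, (∑ x, H x y * w' x i) ^ 2 = Fintype.card Y * Fintype.card X := by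
    have hrow : ∀ x x', ∑ y, H x y * H x' y = if x = x' then (Fintype.card Y : ℝ) else 0 := by
      intro x x'
      split_ifs with h
      · subst h
        simp [← sq, hsq]
      · exact horth x x' h
    calc _ = ∑ i, ∑ x, ∑ x', (w' x i * w' x' i) * ∑ y, H x y * H x' y := by
          rw [Finset.sum_comm]
          refine Finset.sum_congr rfl fun i _ => ?_
          simp only [sq, Finset.sum_mul_sum]
          simp only [Finset.mul_sum]
          rw [Finset.sum_comm]
          refine Finset.sum_congr rfl fun x _ => ?_
          rw [Finset.sum_comm]
          refine Finset.sum_congr rfl fun x' _ => Finset.sum_congr rfl fun y _ => ?_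
          ring
      _ = ∑ i, ∑ x, (w' x i * w' x i) * Fintype.card Y := by simp [hrow]
      _ = ∑ x, (w' x ⬝ᵥ w' x) * Fintype.card Y := by
          rw [Finset.sum_comm]
          simp only [dotProduct, Finset.sum_mul]
      _ = _ := by simp [hw1, mul_comm]
  have hsum : (Fintype.card Y : ℝ) * (Fintype.card X / r) ≤
      ∑ p : Y × Fin r, z' p.1 p.2 * ∑ x, H x p.1 * w' x p.2 := by
    rw [Fintype.sum_prod_type]
    calc _ = ∑ _y : Y, (Fintype.card X : ℝ) / r := by simp
      _ ≤ ∑ y, ∑ x, H x y * (z' y ⬝ᵥ w' x) := Finset.sum_le_sum fun y _ => hlow y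
      _ = _ := by
        refine Finset.sum_congr rfl fun y _ => ?_
        simp only [dotProduct, Finset.mul_sum]
        rw [Finset.sum_comm]
        refine Finset.sum_congr rfl fun i _ => Finset.sum_congr rfl fun x _ => ?_
        ring
  have hCS := Finset.sum_mul_sq_le_sq_mul_sq (Finset.univ : Finset (Y × Fin r))
    (fun p => z' p.1 p.2) fun p => ∑ x, H x p.1 * w' x p.2
  have hZ : ∑ p : Y × Fin r, z' p.1 p.2 ^ 2 = Fintype.card Y := by
    rw [Fintype.sum_prod_type]
    calc _ = ∑ y, z' y ⬝ᵥ z' y := by simp only [dotProduct, sq]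
      _ = _ := by simp [hz1]
  rw [hZ, Fintype.sum_prod_type (f := fun p : Y × Fin r => (∑ x, H x p.1 * w' x p.2) ^ 2), hW]
    at hCS
  have hXpos : (0 : ℝ) < Fintype.card X := by exact_mod_cast Fintype.card_pos
  have hYpos : (0 : ℝ) < Fintype.card Y := by
    have : Nonempty Y := ⟨y₀⟩
    exact_mod_cast Fintype.card_pos
  have hrpos : (0 : ℝ) < r := by exact_mod_cast hr
  have h1 := (pow_le_pow_left₀ (by positivity) hsum 2).trans hCS
  have h2 : (Fintype.card X : ℝ) ≤ (r : ℝ) ^ 2 := by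
    have h3 : ((Fintype.card Y : ℝ) * (Fintype.card X / r)) ^ 2 =
      ((Fintype.card Y : ℝ) * (Fintype.card Y * Fintype.card X)) * (Fintype.card X / r ^ 2) := by
      field_simp
    rw [h3] at h1
    have h4 := (mul_le_iff_le_one_right (by positivity)).1 h1
    rwa [div_le_one (by positivity)] at h4
  exact_mod_cast h2

end Forster

/-! ### Rank of the path weights across a cut -/

section Rank
open scoped Matrix
variable {X Y : Type*}

/-- The matrix `F` has rank at most `r`. -/
def HasRankLE (r : ℕ) (F : X → Y → ℝ) : Prop :=
  ∃ (α : X → Fin r → ℝ) (β : Y → Fin r → ℝ), ∀ x y, F x y = α x ⬝ᵥ β y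

namespace HasRankLE

theorem swap {r : ℕ} {F : X → Y → ℝ} (h : HasRankLE r F) : HasRankLE r fun y x => F x y := by
  obtain ⟨α, β, h⟩ := h
  exact ⟨β, α, fun y x => (h x y).trans (dotProduct_comm _ _)⟩

theorem zero (r : ℕ) : HasRankLE r fun (_ : X) (_ : Y) => (0 : ℝ) :=
  ⟨fun _ => 0, fun _ => 0, fun _ _ => by simp⟩

theorem of_left (g : X → ℝ) : HasRankLE 1 fun x (_ : Y) => g x :=
  ⟨fun x _ => g x, fun _ _ => 1, fun _ _ => by simp [dotProduct]⟩

theorem add {r s : ℕ} {F G : X → Y → ℝ} (hF : HasRankLE r F) (hG : HasRankLE s G) :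
    HasRankLE (r + s) fun x y => F x y + G x y := by
  obtain ⟨α, β, hF⟩ := hF
  obtain ⟨α', β', hG⟩ := hG
  refine ⟨fun x => Fin.append (α x) (α' x), fun y => Fin.append (β y) (β' y), fun x y => ?_⟩
  simp [dotProduct, Fin.sum_univ_add, hF, hG]

theorem mul_right {r : ℕ} {F : X → Y → ℝ} (hF : HasRankLE r F) (g : Y → ℝ) :
    HasRankLE r fun x y => F x y * g y := by
  obtain ⟨α, β, hF⟩ := hF
  exact ⟨α, fun y => g y • β y, fun x y => by simp [hF, mul_comm]⟩

theorem mono {r s : ℕ} {F : X → Y → ℝ} (hF : HasRankLE r F) (h : r ≤ s) : HasRankLE s F := by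
  obtain ⟨q, rfl⟩ := Nat.exists_eq_add_of_le h
  simpa using hF.add (zero q)

theorem sum {r : ℕ} : ∀ {m : ℕ} {F : Fin m → X → Y → ℝ}, (∀ i, HasRankLE r (F i)) →
    HasRankLE (m * r) fun x y => ∑ i, F i x y
  | 0, F, _ => by simpa using zero 0
  | m + 1, F, h => by
    simp only [Fin.sum_univ_castSucc, Nat.succ_mul]
    exact (sum fun i => h i.castSucc).add (h _)

theorem affine {r : ℕ} {F : X → Y → ℝ} (hF : HasRankLE r F) (a b : ℝ) :
    HasRankLE (r + 1) fun x y => F x y * b + a :=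
  (hF.mul_right fun _ => b).add (of_left fun _ => a)

/-- A matrix with orthogonal nonzero rows has full rank. -/
theorem card_le [Fintype X] [Fintype Y] [Nonempty Y] {r : ℕ} {H : X → Y → ℝ}
    (hr : HasRankLE r H) (hsq : ∀ x y, H x y ^ 2 = 1)
    (horth : ∀ x x', x ≠ x' → ∑ y, H x y * H x' y = 0) : Fintype.card X ≤ r := by
  classical
  obtain ⟨α, β, h⟩ := hr
  -- `H Hᵀ` is a nonzero multiple of the identity and factors through dimension `r`.
  have hprod : (Matrix.of α) * ((Matrix.of β)ᵀ * (Matrix.of H)ᵀ) =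
      (Fintype.card Y : ℝ) • (1 : Matrix X X ℝ) := by
    rw [← Matrix.mul_assoc]
    have : (Matrix.of α) * (Matrix.of β)ᵀ = Matrix.of H := by
      ext x y
      simp [Matrix.mul_apply, h, dotProduct]
    rw [this]
    ext x x'
    by_cases hx : x = x'
    · subst hx
      simp [Matrix.mul_apply, ← sq, hsq]
    · simp [Matrix.mul_apply, horth x x' hx, hx]
  have h1 := Matrix.rank_mul_le_left (Matrix.of α) ((Matrix.of β)ᵀ * (Matrix.of H)ᵀ)
  rw [hprod, Matrix.rank_of_isUnit] at h1
  · exact h1.trans ((Matrix.rank_le_card_width _).trans (by simp))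
  · rw [Matrix.isUnit_iff_isUnit_det, Matrix.det_smul, Matrix.det_one, mul_one]
    exact (pow_ne_zero _ (by exact_mod_cast Fintype.card_ne_zero)).isUnit

theorem card_le_sq [Fintype X] [Fintype Y] [Nonempty X] [Nonempty Y] {r : ℕ} {F H : X → Y → ℝ}
    (hr : HasRankLE r F) (hsq : ∀ x y, H x y ^ 2 = 1)
    (horth : ∀ x x', x ≠ x' → ∑ y, H x y * H x' y = 0) (hpos : ∀ x y, 0 < H x y * F x y) :
    Fintype.card X ≤ r ^ 2 := by
  obtain ⟨α, β, h⟩ := hr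
  exact card_le_sq_of_sign_representation hsq horth α β fun x y => h x y ▸ hpos x y

end HasRankLE

variable {size : ℕ → ℕ}

/-- The total weight of the paths to the given node, in a leveled program with weighted edges. -/
def pathWeight (T : (j : ℕ) → Bool → Fin (size j) → Fin (size (j + 1)) → ℝ)
    (init : Fin (size 0) → ℝ) (bits : ℕ → Bool) : (j : ℕ) → Fin (size j) → ℝ
  | 0 => init
  | j + 1 => fun v => ∑ u, pathWeight T init bits j u * T j (bits j) u v

variable (T : (j : ℕ) → Bool → Fin (size j) → Fin (size (j + 1)) → ℝ) (init : Fin (size 0) → ℝ)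

/-- While the tested bits do not depend on `x`, the program acts by a linear map determined by `y`
alone. -/
theorem exists_kernel [Nonempty X] (bits : X → Y → ℕ → Bool) (j l : ℕ) (hjl : j ≤ l)
    (hb : ∀ i, j ≤ i → i < l → ∀ x x' y, bits x y i = bits x' y i) :
    ∃ K : Y → Fin (size j) → Fin (size l) → ℝ, ∀ x y v,
      pathWeight T init (bits x y) l v = ∑ u, pathWeight T init (bits x y) j u * K y u v := by
  classical
  induction l, hjl using Nat.le_induction with
  | base => exact ⟨fun _ u v => if u = v then 1 else 0, fun x y v => by simp⟩
  | succ l hjl ih =>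
    obtain ⟨K, hK⟩ := ih fun i h1 h2 => hb i h1 (by omega)
    obtain ⟨x₀⟩ := ‹Nonempty X›
    refine ⟨fun y u v => ∑ w, K y u w * T l (bits x₀ y l) w v, fun x y v => ?_⟩
    simp only [pathWeight, hK, hb l hjl (by omega) x x₀ y, Finset.sum_mul, Finset.mul_sum]
    rw [Finset.sum_comm]
    simp only [mul_assoc]

/-- One crossing of the cut costs a factor `d`: the new weight is a sum over the at most `d` nodes
where the segment starts of an old weight times a function of `y`. -/
theorem HasRankLE.pathWeight_right [Nonempty X] {bits : X → Y → ℕ → Bool} {j l d r : ℕ}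
    (hjl : j ≤ l) (hb : ∀ i, j ≤ i → i < l → ∀ x x' y, bits x y i = bits x' y i)
    (hd : size j ≤ d) (hr : ∀ u, HasRankLE r fun x y => pathWeight T init (bits x y) j u)
    (v : Fin (size l)) : HasRankLE (d * r) fun x y => pathWeight T init (bits x y) l v := by
  obtain ⟨K, hK⟩ := exists_kernel T init bits j l hjl hb
  simp only [hK]
  exact (HasRankLE.sum fun u => (hr u).mul_right fun y => K y u v).mono
    (Nat.mul_le_mul_right r hd)

theorem HasRankLE.pathWeight_left [Nonempty Y] {bits : X → Y → ℕ → Bool} {j l d r : ℕ}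
    (hjl : j ≤ l) (hb : ∀ i, j ≤ i → i < l → ∀ x y y', bits x y i = bits x y' i)
    (hd : size j ≤ d) (hr : ∀ u, HasRankLE r fun x y => pathWeight T init (bits x y) j u)
    (v : Fin (size l)) : HasRankLE (d * r) fun x y => pathWeight T init (bits x y) l v :=
  (HasRankLE.pathWeight_right T init (bits := fun y x => bits x y) hjl
    (fun i h1 h2 y y' x => hb i h1 h2 x y y') hd (fun u => (hr u).swap) v).swap

variable {n c : ℕ} (π : Equiv.Perm (Fin n))

/-- The inputs `inp x y` are split by the cut `c`: of the variables read before the cut only `x`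
is seen, and of those read after the cut only `y`. -/
def SplitAt (inp : X → Y → Fin n → Bool) (c : ℕ) : Prop :=
  (∀ i : Fin n, (i : ℕ) < c → ∀ x y y', inp x y (π i) = inp x y' (π i)) ∧
    ∀ i : Fin n, c ≤ (i : ℕ) → ∀ x x' y, inp x y (π i) = inp x' y (π i)

variable {π}

/-- Up to the first cut the weights depend on `x` only, which is rank 1. Each of the remaining `2 *
k - 1` segments multiplies the rank by `d`. Only the levels where segments start matter; they are
inner levels because `c < n`, so the size of the sink level is irrelevant. -/
theorem SplitAt.hasRankLE [Nonempty X] [Nonempty Y] {inp : X → Y → Fin n → Bool}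
    (h : SplitAt π inp c) (hc : c < n) {k d : ℕ} (hsize : ∀ j < k * n, size j ≤ d) (hk : 1 ≤ k)
    (v : Fin (size (k * n))) :
    HasRankLE (d ^ (2 * k - 1)) fun x y =>
      pathWeight T init (testedBit π (inp x y)) (k * n) v := by
  have hn : 0 < n := by omega
  have hmod : ∀ t i, t * n ≤ i → i < t * n + n → i % n = i - t * n := by
    intro t i h1 h2
    obtain ⟨q, rfl⟩ := Nat.exists_eq_add_of_le h1
    rw [Nat.mul_add_mod', Nat.mod_eq_of_lt (by omega)]
    omega
  have hleft : ∀ t i, t * n ≤ i → i < t * n + c → ∀ x y y',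
      testedBit π (inp x y) i = testedBit π (inp x y') i := by
    intro t i h1 h2 x y y'
    have := hmod t i h1 (by omega)
    simp only [testedBit, hn, dif_pos]
    exact h.1 _ (by simp only; omega) x y y'
  have hright : ∀ t i, t * n + c ≤ i → i < t * n + n → ∀ x x' y,
      testedBit π (inp x y) i = testedBit π (inp x' y) i := by
    intro t i h1 h2 x x' y
    have := hmod t i (by omega) (by omega)
    simp only [testedBit, hn, dif_pos]
    exact h.2 _ (by simp only; omega) x x' y
  have hcut : ∀ t < k, ∀ v, HasRankLE (d ^ (2 * t)) fun x y =>
      pathWeight T init (testedBit π (inp x y)) (t * n + c) v := by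
    intro t
    induction t with
    | zero =>
      intro _ v
      obtain ⟨K, hK⟩ := exists_kernel T init (fun (y : Y) (x : X) => testedBit π (inp x y)) 0
        (0 * n + c) (by omega) fun i h1 h2 y y' x => hleft 0 i (by omega) h2 x y y'
      have : (fun x y => pathWeight T init (testedBit π (inp x y)) (0 * n + c) v) =
          fun x _ => ∑ u, init u * K x u v := by
        funext x y
        exact hK y x v
      rw [this]
      simpa using HasRankLE.of_left _
    | succ t ih =>
      intro ht v
      have hkn : (t + 1) * n + n ≤ k * n := by
        rw [← Nat.succ_mul]
        exact Nat.mul_le_mul_right n ht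
      have h1 : (t + 1) * n = t * n + n := Nat.succ_mul t n
      have hB := HasRankLE.pathWeight_right T init (l := (t + 1) * n)
        (bits := fun x y => testedBit π (inp x y)) (by omega)
        (fun i h2 h3 => hright t i h2 (by omega)) (hsize _ (by omega)) (ih (by omega))
      have hA := HasRankLE.pathWeight_left T init (l := (t + 1) * n + c)
        (bits := fun x y => testedBit π (inp x y)) (by omega)
        (hleft (t + 1)) (hsize _ (by omega)) hB v
      have : d ^ (2 * (t + 1)) = d * (d * d ^ (2 * t)) := by ring
      rwa [this]
  obtain ⟨t, rfl⟩ : ∃ t, k = t + 1 := ⟨k - 1, by omega⟩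
  have h1 : (t + 1) * n = t * n + n := Nat.succ_mul t n
  have hB := HasRankLE.pathWeight_right T init (l := (t + 1) * n)
    (bits := fun x y => testedBit π (inp x y)) (by omega)
    (fun i h2 h3 => hright t i h2 (by omega)) (hsize _ (by omega)) (hcut t (by omega)) v
  have : d ^ (2 * (t + 1) - 1) = d * d ^ (2 * t) := by
    rw [← pow_succ']; congr 1
  rwa [this]

end Rank

/-! ### From programs to low rank and sign rank -/

section Programs
variable {n k : ℕ}

theorem LeveledShape.size_le {P : LeveledShape n k} {d : ℕ} (h : P.width ≤ d) (j : ℕ)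
    (hj : j < k * n) : P.size j ≤ d :=
  (Finset.le_sup (f := P.size) (Finset.mem_range.2 hj)).trans h

/-- The program that takes each step with certainty. -/
def DetProgram.toProb (P : DetProgram n k) : ProbProgram n k where
  toLeveledShape := P.toLeveledShape
  prob j b u v := if v = P.next j b u then 1 else 0
  prob_nonneg j b u v := by split_ifs <;> norm_num
  prob_sum j b u := by simp

theorem DetProgram.dist_toProb (P : DetProgram n k) (x : Fin n → Bool) (j : ℕ) :
    P.toProb.dist x j = fun v => if v = P.state x j then 1 else 0 := by
  induction j with
  | zero => rfl
  | succ j ih =>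
    funext v
    simp only [ProbProgram.dist, ih, ite_mul, one_mul, zero_mul]
    exact (Finset.sum_ite_eq' _ _ _).trans (if_pos (Finset.mem_univ _))

theorem DetProgram.acceptProb_toProb {P : DetProgram n k} {f : BoolFn n} (h : P.Computes f)
    (x : Fin n → Bool) : P.toProb.acceptProb x = if f x = true then 1 else 0 := by
  have h1 : P.toProb.acceptProb x = if P.sink = P.state x (k * n) then 1 else 0 :=
    congrFun (P.dist_toProb x (k * n)) P.sink
  rw [h1]
  exact if_congr (eq_comm.trans (h x).symm) rfl rfl

/-- The program that has just the edges of a deterministic program. -/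
def DetProgram.toNondet (P : DetProgram n k) : NondetProgram n k where
  toLeveledShape := P.toLeveledShape
  edge j b u v := v = P.next j b u

theorem DetProgram.reachable_toNondet (P : DetProgram n k) (x : Fin n → Bool) (j : ℕ) :
    P.toNondet.reachable x j = {P.state x j} := by
  induction j with
  | zero => rfl
  | succ j ih =>
    ext v
    simp only [NondetProgram.reachable, ih]
    constructor
    · rintro ⟨u, hu, hv⟩
      obtain rfl := Set.mem_singleton_iff.1 hu
      exact hv
    · intro hv
      exact ⟨_, rfl, hv⟩

theorem kOBDD_subset_kNOBDD (W : ℝ) : kOBDD n k W ⊆ kNOBDD n k W := by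
  rintro f ⟨P, hW, hf⟩
  refine ⟨P.toNondet, hW, fun x => ?_⟩
  rw [hf x, P.reachable_toNondet]
  exact eq_comm

theorem kOBDD_subset_kPOBDD {ε : ℝ} (hε : ε ≤ 1 / 2) (W : ℝ) : kOBDD n k W ⊆ kPOBDD n k ε W := by
  rintro f ⟨P, hW, hf⟩
  refine ⟨P.toProb, hW, fun x => ?_⟩
  rw [DetProgram.acceptProb_toProb hf]
  split_ifs <;> linarith

theorem ProbProgram.dist_eq_pathWeight (P : ProbProgram n k) (x : Fin n → Bool) (j : ℕ) :
    P.dist x j = pathWeight P.prob (fun v => if v = P.source then 1 else 0)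
      (testedBit P.order x) j := by
  induction j with
  | zero => rfl
  | succ j ih => funext v; simp only [ProbProgram.dist, pathWeight, ih]

open Classical in
/-- The edges of a nondeterministic program, as weights. -/
noncomputable def NondetProgram.weight (P : NondetProgram n k) (j : ℕ) (b : Bool)
    (u : Fin (P.size j)) (v : Fin (P.size (j + 1))) : ℝ :=
  if P.edge j b u v then 1 else 0

/-- The number of consistent paths to a node. -/
noncomputable def NondetProgram.pathCount (P : NondetProgram n k) (x : Fin n → Bool) :
    (j : ℕ) → Fin (P.size j) → ℝ :=
  pathWeight P.weight (fun v => if v = P.source then 1 else 0) (testedBit P.order x)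

/-- The count may exceed 1, so it does not represent the function itself; but subtracting 1/2 gives
the right signs. -/
theorem NondetProgram.pathCount_spec (P : NondetProgram n k) (x : Fin n → Bool) (j : ℕ)
    (v : Fin (P.size j)) : (v ∈ P.reachable x j → 1 ≤ P.pathCount x j v) ∧
      (v ∉ P.reachable x j → P.pathCount x j v = 0) := by
  induction j with
  | zero =>
    have h : P.pathCount x 0 v = if v = P.source then 1 else 0 := rfl
    have h' : v ∈ P.reachable x 0 ↔ v = P.source := Iff.rfl
    rw [h, h']
    constructor <;> intro hv <;> simp [hv]
  | succ j ih =>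
    have h : P.pathCount x (j + 1) v =
        ∑ u, P.pathCount x j u * P.weight j (testedBit P.order x j) u v := rfl
    have hnn : ∀ u, 0 ≤ P.pathCount x j u * P.weight j (testedBit P.order x j) u v := by
      intro u
      refine mul_nonneg ?_ ?_
      · by_cases hu : u ∈ P.reachable x j
        · exact zero_le_one.trans ((ih u).1 hu)
        · exact ((ih u).2 hu).symm.le
      · unfold NondetProgram.weight
        split_ifs <;> norm_num
    rw [h]
    constructor
    · rintro ⟨u, hu, hv⟩
      refine le_trans ?_ (Finset.single_le_sum (fun u _ => hnn u) (Finset.mem_univ u))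
      rw [NondetProgram.weight, if_pos hv, mul_one]
      exact (ih u).1 hu
    · intro hv
      refine Finset.sum_eq_zero fun u _ => ?_
      by_cases hu : u ∈ P.reachable x j
      · rw [NondetProgram.weight, if_neg fun he => hv ⟨u, hu, he⟩, mul_zero]
      · rw [(ih u).2 hu, zero_mul]

variable {X Y : Type*} {f : BoolFn n}

/-- The sign matrix of a function on a family of inputs. -/
def signMatrix (f : BoolFn n) (inp : X → Y → Fin n → Bool) (x : X) (y : Y) : ℝ :=
  if f (inp x y) = true then -1 else 1

/-- In every order the inputs can be split such that the sign matrix has `N` orthogonal rows. -/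
def SplitsHard (f : BoolFn n) (N : ℕ) : Prop :=
  ∀ π : Equiv.Perm (Fin n), ∃ (X Y : Type) (_ : Fintype X) (_ : Fintype Y) (_ : Nonempty X)
    (_ : Nonempty Y) (inp : X → Y → Fin n → Bool) (c : ℕ), c < n ∧ SplitAt π inp c ∧
    Fintype.card X = N ∧
    ∀ x x', x ≠ x' → ∑ y, signMatrix f inp x y * signMatrix f inp x' y = 0

theorem signMatrix_sq (f : BoolFn n) (inp : X → Y → Fin n → Bool) (x : X) (y : Y) :
    signMatrix f inp x y ^ 2 = 1 := by
  unfold signMatrix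
  split_ifs <;> norm_num

/-- Acceptance is exactly 0 or 1, so `1 - 2 * accept` is the sign matrix itself and ordinary rank
suffices, without the square. -/
theorem SplitsHard.le_of_det {N d : ℕ} (h : SplitsHard f N) (hk : 1 ≤ k) {P : DetProgram n k}
    (hd : P.width ≤ d) (hP : P.Computes f) : N ≤ d ^ (2 * k - 1) + 1 := by
  obtain ⟨X, Y, _, _, _, _, inp, c, hc, hs, rfl, horth⟩ := h P.order
  have hr := (hs.hasRankLE P.toProb.prob (fun v => if v = P.toProb.source then 1 else 0) hc
    (P.size_le hd) hk P.toProb.sink).affine 1 (-2)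
  refine HasRankLE.card_le (H := signMatrix f inp) ?_ (signMatrix_sq f inp) horth
  convert hr using 3 with x y
  have h1 := P.acceptProb_toProb hP (inp x y)
  have h2 : P.toProb.acceptProb (inp x y) = pathWeight P.toProb.prob
      (fun v => if v = P.toProb.source then 1 else 0) (testedBit P.order (inp x y)) (k * n) P.toProb.sink :=
    congrFun (P.toProb.dist_eq_pathWeight (inp x y) (k * n)) P.toProb.sink
  rw [← h2, h1, signMatrix]
  split_ifs <;> norm_num

theorem SplitsHard.le_of_nondet {N d : ℕ} (h : SplitsHard f N) (hk : 1 ≤ k)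
    {P : NondetProgram n k} (hd : P.width ≤ d) (hP : P.Computes f) :
    N ≤ (d ^ (2 * k - 1) + 1) ^ 2 := by
  obtain ⟨X, Y, _, _, _, _, inp, c, hc, hs, rfl, horth⟩ := h P.order
  have hr := (hs.hasRankLE P.weight (fun v => if v = P.source then 1 else 0) hc
    (P.size_le hd) hk P.sink).affine (1 / 2) (-1)
  refine hr.card_le_sq (H := signMatrix f inp) (signMatrix_sq f inp) horth fun x y => ?_
  have h1 := P.pathCount_spec (inp x y) (k * n) P.sink
  unfold NondetProgram.pathCount at h1
  rw [← hP (inp x y)] at h1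
  rw [signMatrix]
  split_ifs with hf
  · linarith [h1.1 hf]
  · rw [h1.2 hf]
    norm_num

/-- The sign of `1 / 2 - accept` is right for every positive `ε`, however small; sign rank does not
see the size of the gap. -/
theorem SplitsHard.le_of_prob {N d : ℕ} (h : SplitsHard f N) (hk : 1 ≤ k)
    {P : ProbProgram n k} (hd : P.width ≤ d) {ε : ℝ} (hε : 0 < ε) (hP : P.Computes ε f) :
    N ≤ (d ^ (2 * k - 1) + 1) ^ 2 := by
  obtain ⟨X, Y, _, _, _, _, inp, c, hc, hs, rfl, horth⟩ := h P.order
  have hr := (hs.hasRankLE P.prob (fun v => if v = P.source then 1 else 0) hc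
    (P.size_le hd) hk P.sink).affine (1 / 2) (-1)
  refine hr.card_le_sq (H := signMatrix f inp) (signMatrix_sq f inp) horth fun x y => ?_
  have h1 := hP (inp x y)
  rw [ProbProgram.acceptProb, P.dist_eq_pathWeight] at h1
  rw [signMatrix]
  split_ifs at h1 ⊢ with hf <;> linarith

end Programs

/-! ### A register machine and its block code -/

section Machine

/-- Apply `g 0`, `g 1`, …, `g (c - 1)` one after the other. -/
def applySeq {S : Type*} (g : ℕ → S → S) : ℕ → S → S
  | 0, s => s
  | c + 1, s => g c (applySeq g c s)

theorem applySeq_congr {S : Type*} {g g' : ℕ → S → S} {c : ℕ} (h : ∀ i < c, g i = g' i) (s : S) :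
    applySeq g c s = applySeq g' c s := by
  induction c with
  | zero => rfl
  | succ c ih => rw [applySeq, applySeq, ih fun i hi => h i (by omega), h c (by omega)]

theorem applySeq_add {S : Type*} (g : ℕ → S → S) (a b : ℕ) (s : S) :
    applySeq g (a + b) s = applySeq (fun i => g (a + i)) b (applySeq g a s) := by
  induction b with
  | zero => rfl
  | succ b ih => rw [← add_assoc, applySeq, applySeq, ih]

theorem applySeq_mul {S : Type*} (g : ℕ → S → S) (a b : ℕ) (s : S) :
    applySeq g (a * b) s = applySeq (fun i => applySeq (fun j => g (i * b + j)) b) a s := by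
  induction a with
  | zero => simp [applySeq]
  | succ a ih => rw [Nat.succ_mul, applySeq_add, ih, applySeq]

theorem applySeq_id {S : Type*} {g : ℕ → S → S} {c : ℕ} {s : S} (h : ∀ i < c, g i s = s) :
    applySeq g c s = s := by
  induction c with
  | zero => rfl
  | succ c ih => rw [applySeq, ih fun i hi => h i (by omega), h c (by omega)]

theorem applySeq_semiconj {S R : Type*} (φ : R → S) {g : ℕ → S → S} {g' : ℕ → R → R} {c : ℕ}
    (h : ∀ i < c, ∀ s, g i (φ s) = φ (g' i s)) (s : R) :
    applySeq g c (φ s) = φ (applySeq g' c s) := by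
  induction c with
  | zero => rfl
  | succ c ih => rw [applySeq, applySeq, ih fun i hi => h i (by omega), h c (by omega)]

theorem applySeq_getD {S ι : Type*} (g : ι → S → S) (d : ι) (l : List ι) (s : S) :
    applySeq (fun o => g (l.getD o d)) l.length s = l.foldl (fun s i => g i s) s := by
  induction l using List.reverseRecOn with
  | nil => rfl
  | append_singleton l a ih =>
    rw [List.length_append, List.length_singleton, applySeq, List.foldl_append, ← ih]
    simp only [List.foldl_cons, List.foldl_nil]
    rw [List.getD_append_right _ _ _ _ le_rfl]
    simp only [Nat.sub_self, List.getD_cons_zero]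
    congr 1
    exact applySeq_congr (fun i hi => by rw [List.getD_append _ _ _ _ hi]) s

theorem eq_length_of_getD_eq {ι : Type*} {l l' : List ι} {a d : ι} (hl : a ∉ l) (hl' : a ∉ l')
    (hd : a ≠ d) {o : ℕ} (h : (l ++ a :: l').getD o d = a) : o = l.length := by
  rcases lt_trichotomy o l.length with ho | ho | ho
  · rw [List.getD_append _ _ _ _ ho, List.getD_eq_getElem _ _ ho] at h
    exact absurd (h ▸ List.getElem_mem ho) hl
  · exact ho
  · obtain ⟨q, rfl⟩ := Nat.exists_eq_add_of_lt ho
    rw [List.getD_append_right _ _ _ _ (by omega), show l.length + q + 1 - l.length = q + 1 by omega,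
      List.getD_cons_succ] at h
    rcases lt_or_ge q l'.length with hq | hq
    · rw [List.getD_eq_getElem _ _ hq] at h
      exact absurd (h ▸ List.getElem_mem hq) hl'
    · rw [List.getD_eq_default _ _ hq] at h
      exact absurd h.symm hd

/-- A function that a machine with the states `S` computes, in `k` passes over the input, is computed
by a deterministic program of that width. -/
theorem mem_kOBDD_of_machine {n k : ℕ} {S : Type*} [Fintype S] (hkn : 0 < k * n) (s₀ a b : S)
    (hab : a ≠ b) (step : ℕ → Bool → S → S) (acc : S → Bool) (f : BoolFn n)
    (hf : ∀ x, f x = acc (applySeq (fun j => step j (testedBit 1 x j)) (k * n) s₀)) {W : ℝ}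
    (hW : (Fintype.card S : ℝ) ≤ W) : f ∈ kOBDD n k W := by
  let E := Fintype.equivFin S
  -- There is only one accepting sink, so the last step merges all accepting states into `a` and the
  -- others into `b`.
  let out : ℕ → S → S := fun j s => if j + 1 = k * n then (if acc s then a else b) else s
  let P : DetProgram n k :=
    { order := 1
      size := fun _ => Fintype.card S
      source := E s₀
      sink := E a
      next := fun j v u => E (out j (step j v (E.symm u))) }
  have hstate : ∀ x, ∀ j < k * n,
      P.state x j = E (applySeq (fun j => step j (testedBit 1 x j)) j s₀) := by
    intro x j
    induction j with
    | zero => intro _; rfl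
    | succ j ih =>
      intro hj
      change E (out j (step j (testedBit 1 x j) (E.symm (P.state x j)))) = _
      rw [ih (by omega), Equiv.symm_apply_apply]
      simp only [out, if_neg hj.ne]
      rfl
  refine ⟨P, le_trans ?_ hW, fun x => ?_⟩
  · exact_mod_cast Finset.sup_le fun j _ => le_rfl
  · obtain ⟨l, hl⟩ : ∃ l, k * n = l + 1 := ⟨k * n - 1, by omega⟩
    have hlast : ∀ l, (hl : k * n = l + 1) →
        (P.state x (k * n) = P.sink ↔ P.state x (l + 1) = E a) := by
      intro l hl
      have : ∀ j, j = l + 1 → ((P.state x j : Fin (Fintype.card S)) = E a ↔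
          P.state x (l + 1) = E a) := by
        rintro j rfl; rfl
      exact this _ hl
    rw [hlast l hl, hf x, hl]
    change _ ↔ E (out l (step l (testedBit 1 x l) (E.symm (P.state x l)))) = E a
    rw [hstate x l (by omega), Equiv.symm_apply_apply, E.apply_eq_iff_eq]
    simp only [out, if_pos hl.symm, applySeq]
    split_ifs with h
    · simp [h]
    · simp [h, hab.symm]

/-- The instructions of a machine with `p` one-bit registers, a parity bit and a flag. -/
inductive Instr (p : ℕ)
  | select (q : ℕ)
  | clear (j : Fin p)
  | value
  | set (j : Fin p)
  | get (j : Fin p)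
  | add
  | skip

/-- The registers, the parity bit, and the flag. -/
abbrev MachineState (p : ℕ) : Type := (Fin p → Bool) × Bool × Bool

/-- The effect of an instruction with argument `b` in layer `t`. -/
def Instr.run {p : ℕ} (t : ℕ) : Instr p → Bool → MachineState p → MachineState p
  | select q, b, (r, s, e) => (r, s, e && (b == t.testBit q))
  | clear j, b, (r, s, e) => (if e && b then Function.update r j false else r, s, e)
  | value, b, (r, s, e) => (r, s, e && b)
  | set j, b, (r, s, e) => (if e && b then Function.update r j true else r, s, e)
  | get j, b, (r, s, e) => (r, s, e && (!b || r j))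
  | add, b, (r, s, e) => (r, s ^^ (b && e), true)
  | skip, _, st => st

/-- The instructions of a block before the value. -/
def blockHead (L p : ℕ) : List (Instr p) :=
  (List.range L).map Instr.select ++ (List.finRange p).map Instr.clear

/-- The instructions of a block after the value. -/
def blockTail (p : ℕ) : List (Instr p) :=
  (List.finRange p).map Instr.set ++ ((List.finRange p).map Instr.get ++ [Instr.add])

/-- The instructions of a block. -/
def blockInstrs (L p : ℕ) : List (Instr p) := blockHead L p ++ Instr.value :: blockTail p

theorem length_blockHead (L p : ℕ) : (blockHead L p).length = L + p := by simp [blockHead]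

theorem length_blockInstrs (L p : ℕ) : (blockInstrs L p).length = L + 3 * p + 2 := by
  simp [blockInstrs, blockHead, blockTail]; omega

theorem eq_of_getD_blockInstrs_eq_value {L p o : ℕ}
    (h : (blockInstrs L p).getD o Instr.skip = Instr.value) : o = L + p := by
  rw [← length_blockHead L p]
  exact eq_length_of_getD_eq (by simp [blockHead]) (by simp [blockTail]) (by simp) h

/-- What the rest of a block can tell the machine to do with the value in it: in one of the layers,
multiply it with a register and add the result to the parity, or write it into a register. -/
structure BlockTask (p : ℕ) where
  layer : ℕ
  reg : Fin p
  read : Bool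

/-- The arguments of the instructions of a block that encode a task and a value. -/
def BlockTask.arg {p : ℕ} (τ : BlockTask p) (x : Bool) : Instr p → Bool
  | .select q => τ.layer.testBit q
  | .clear j => !τ.read && j == τ.reg
  | .value => x
  | .set j => !τ.read && j == τ.reg
  | .get j => τ.read && j == τ.reg
  | .add => τ.read
  | .skip => false

/-- The effect of a task in layer `t` on the registers and the parity. -/
def BlockTask.effect {p : ℕ} (t : ℕ) (τ : BlockTask p) (x : Bool) (st : (Fin p → Bool) × Bool) :
    (Fin p → Bool) × Bool :=
  if τ.layer = t then
    if τ.read then (st.1, st.2 ^^ (x && st.1 τ.reg)) else (Function.update st.1 τ.reg x, st.2)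
  else st

section Block
variable {p : ℕ} (t : ℕ) (τ : BlockTask p) (x : Bool) (r : Fin p → Bool) (s e : Bool)

theorem foldl_select (L : ℕ) :
    ((List.range L).map Instr.select).foldl (fun st i => i.run t (τ.arg x i) st) (r, s, e) =
      (r, s, e && decide (∀ q < L, τ.layer.testBit q = t.testBit q)) := by
  induction L with
  | zero => simp
  | succ L ih =>
    rw [List.range_succ, List.map_append, List.foldl_append, ih]
    simp only [List.map_cons, List.map_nil, List.foldl_cons, List.foldl_nil, Instr.run,
      BlockTask.arg, Prod.mk.injEq, true_and, Bool.and_assoc, Nat.forall_lt_succ_right,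
      Bool.decide_and]
    congr 2

theorem foldl_clear (l : List (Fin p)) :
    (l.map Instr.clear).foldl (fun st i => i.run t (τ.arg x i) st) (r, s, e) =
      (if e && !τ.read && decide (τ.reg ∈ l) then Function.update r τ.reg false else r, s, e) := by
  induction l using List.reverseRecOn with
  | nil => simp
  | append_singleton l a ih =>
    rw [List.map_append, List.foldl_append, ih]
    simp only [List.map_cons, List.map_nil, List.foldl_cons, List.foldl_nil, Instr.run,
      BlockTask.arg]
    by_cases ha : a = τ.reg
    · subst ha
      cases e <;> cases τ.read <;> simp
      split_ifs <;> simp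
    · cases e <;> cases τ.read <;> simp [ha, Ne.symm ha]

theorem foldl_set (l : List (Fin p)) :
    (l.map Instr.set).foldl (fun st i => i.run t (τ.arg x i) st) (r, s, e) =
      (if e && !τ.read && decide (τ.reg ∈ l) then Function.update r τ.reg true else r, s, e) := by
  induction l using List.reverseRecOn with
  | nil => simp
  | append_singleton l a ih =>
    rw [List.map_append, List.foldl_append, ih]
    simp only [List.map_cons, List.map_nil, List.foldl_cons, List.foldl_nil, Instr.run,
      BlockTask.arg]
    by_cases ha : a = τ.reg
    · subst ha
      cases e <;> cases τ.read <;> simp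
      split_ifs <;> simp
    · cases e <;> cases τ.read <;> simp [ha, Ne.symm ha]

theorem foldl_get (l : List (Fin p)) :
    (l.map Instr.get).foldl (fun st i => i.run t (τ.arg x i) st) (r, s, e) =
      (r, s, e && (!(τ.read && decide (τ.reg ∈ l)) || r τ.reg)) := by
  induction l using List.reverseRecOn with
  | nil => simp
  | append_singleton l a ih =>
    rw [List.map_append, List.foldl_append, ih]
    simp only [List.map_cons, List.map_nil, List.foldl_cons, List.foldl_nil, Instr.run,
      BlockTask.arg]
    by_cases ha : a = τ.reg
    · subst ha
      cases e <;> cases τ.read <;> simp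
      cases r τ.reg <;> simp
    · cases e <;> cases τ.read <;> simp [ha, Ne.symm ha]

/-- After the selection the flag says whether the task belongs to layer `t`; `L` bits decide this
because both numbers are below `2 ^ L`. The flag must then also carry the value, so a write first
clears the register, then lets the value into the flag, and sets the register if the flag is still
up. A read lets the register into the flag, which then holds the product for `add`; `add` raises the
flag again. -/
theorem foldl_blockInstrs {L : ℕ} (ht : t < 2 ^ L) (hτ : τ.layer < 2 ^ L) :
    (blockInstrs L p).foldl (fun st i => i.run t (τ.arg x i) st) (r, s, true) =
      ((τ.effect t x (r, s)).1, (τ.effect t x (r, s)).2, true) := by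
  have hlayer : (∀ q < L, τ.layer.testBit q = t.testBit q) ↔ τ.layer = t := by
    constructor
    · intro h
      refine Nat.eq_of_testBit_eq fun q => ?_
      rcases lt_or_ge q L with hq | hq
      · exact h q hq
      · rw [Nat.testBit_eq_false_of_lt (hτ.trans_le (Nat.pow_le_pow_right two_pos hq)),
          Nat.testBit_eq_false_of_lt (ht.trans_le (Nat.pow_le_pow_right two_pos hq))]
    · rintro rfl _ _
      rfl
  have hvalue : ∀ (r : Fin p → Bool) s e, Instr.value.run t (τ.arg x Instr.value) (r, s, e) = (r, s, e && x) :=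
    fun _ _ _ => rfl
  unfold blockInstrs blockHead blockTail
  rw [List.foldl_append, List.foldl_append, foldl_select, foldl_clear, List.foldl_cons,
    List.foldl_append, hvalue, foldl_set, List.foldl_append, foldl_get]
  simp only [List.foldl_cons, List.foldl_nil, Instr.run, BlockTask.arg, hlayer, BlockTask.effect]
  by_cases h : τ.layer = t
  · cases τ.read <;> cases x <;> simp [h]
  · simp [h]

end Block
end Machine

/-! ### The register function and the effect of groups of tasks -/

section RegisterFunction
variable {p : ℕ}

/-- The instruction at place `i` of a layer with `N` blocks. -/
def layerInstr (L p N i : ℕ) : Instr p :=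
  if i / (L + 3 * p + 2) < N then (blockInstrs L p).getD (i % (L + 3 * p + 2)) Instr.skip
  else Instr.skip

/-- The function computed by the register machine with `p` registers in `k` layers of `N` blocks. -/
def registerFn (n k L p N : ℕ) : BoolFn n := fun x =>
  (applySeq (fun j => (layerInstr L p N (j % n)).run (j / n) (testedBit 1 x j)) (k * n)
    ((fun _ => false, false, true) : MachineState p)).2.1

/-- The input that encodes tasks and values for the blocks. -/
def taskInput (n L N : ℕ) (τ : ℕ → BlockTask p) (v : ℕ → Bool) : Fin n → Bool := fun i =>
  (τ (i / (L + 3 * p + 2))).arg (v (i / (L + 3 * p + 2))) (layerInstr L p N i)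

/-- The value slot, at offset `L + p` of a block, is the only place where the input depends on the
values. -/
theorem taskInput_congr {n L N : ℕ} {τ : ℕ → BlockTask p} {v v' : ℕ → Bool} {i : Fin n}
    (h : ∀ b < N, (i : ℕ) = b * (L + 3 * p + 2) + (L + p) → v b = v' b) :
    taskInput n L N τ v i = taskInput n L N τ v' i := by
  unfold taskInput
  by_cases hi : layerInstr L p N i = Instr.value
  · have h1 : (i : ℕ) / (L + 3 * p + 2) < N := by
      by_contra h0
      rw [layerInstr, if_neg h0] at hi
      cases hi
    have h2 : (i : ℕ) % (L + 3 * p + 2) = L + p := by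
      rw [layerInstr, if_pos h1] at hi
      exact eq_of_getD_blockInstrs_eq_value hi
    rw [h _ h1 (by rw [← h2, Nat.div_add_mod'])]
  · generalize layerInstr L p N i = I at hi
    cases I <;> first | rfl | exact absurd rfl hi

theorem registerFn_taskInput {n k L N : ℕ} {τ : ℕ → BlockTask p} {v : ℕ → Bool} (hk : k ≤ 2 ^ L)
    (hτ : ∀ b < N, (τ b).layer < 2 ^ L) (hN : N * (L + 3 * p + 2) ≤ n) (hn : 0 < n) :
    registerFn n k L p N (taskInput n L N τ v) =
      (applySeq (fun t => applySeq (fun b => (τ b).effect t (v b)) N) k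
        (fun _ => false, false)).2 := by
  unfold registerFn
  rw [applySeq_mul]
  have hφ := applySeq_semiconj (fun st : (Fin p → Bool) × Bool => ((st.1, st.2, true) :
    MachineState p)) (g := fun t => applySeq (fun i =>
      (layerInstr L p N ((t * n + i) % n)).run ((t * n + i) / n)
        (testedBit 1 (taskInput n L N τ v) (t * n + i))) n)
    (g' := fun t => applySeq (fun b => (τ b).effect t (v b)) N) (c := k) ?_ (fun _ => false, false)
  · rw [hφ]
  intro t ht st
  obtain ⟨q, hq⟩ := Nat.exists_eq_add_of_le hN
  have hbit : ∀ i < n, (layerInstr L p N ((t * n + i) % n)).run ((t * n + i) / n)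
      (testedBit 1 (taskInput n L N τ v) (t * n + i)) = (layerInstr L p N i).run t
        ((τ (i / (L + 3 * p + 2))).arg (v (i / (L + 3 * p + 2))) (layerInstr L p N i)) := by
    intro i hi
    have h1 : (t * n + i) % n = i := by rw [Nat.mul_add_mod', Nat.mod_eq_of_lt hi]
    have h2 : (t * n + i) / n = t := by
      rw [mul_comm, Nat.mul_add_div hn, Nat.div_eq_of_lt hi, add_zero]
    rw [h2]
    simp only [testedBit, hn, dif_pos, taskInput, Equiv.Perm.coe_one, id_eq, h1]
  rw [applySeq_congr hbit]
  -- Separate the `N` full blocks from the `q` places at the end of the layer, which are skipped.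
  conv_lhs => rw [hq]
  rw [applySeq_add, applySeq_id, applySeq_mul]
  · refine applySeq_semiconj (fun st : (Fin p → Bool) × Bool => ((st.1, st.2, true) :
      MachineState p)) ?_ st
    intro b hb st
    rw [← foldl_blockInstrs t (τ b) (v b) st.1 st.2 (ht.trans_le hk) (hτ b hb),
      ← applySeq_getD (fun i st => i.run t ((τ b).arg (v b) i) st) Instr.skip,
      length_blockInstrs]
    refine applySeq_congr (fun o ho => ?_) _
    have h1 : (b * (L + 3 * p + 2) + o) / (L + 3 * p + 2) = b := by
      rw [mul_comm, Nat.mul_add_div (by omega), Nat.div_eq_of_lt ho, add_zero]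
    have h2 : (b * (L + 3 * p + 2) + o) % (L + 3 * p + 2) = o := by
      rw [Nat.mul_add_mod', Nat.mod_eq_of_lt ho]
    have h3 : layerInstr L p N (b * (L + 3 * p + 2) + o) =
        (blockInstrs L p).getD o Instr.skip := by
      rw [layerInstr, h1, h2, if_pos hb]
    rw [h1, h3]
  · intro i hi
    have h1 : layerInstr L p N (N * (L + 3 * p + 2) + i) = Instr.skip := by
      rw [layerInstr, if_neg]
      rw [not_lt, Nat.le_div_iff_mul_le (by omega)]
      omega
    rw [h1]
    rfl

theorem registerFn_mem_kOBDD {n k L N : ℕ} (hkn : 0 < k * n) {W : ℝ} (hW : 2 ^ p * 4 ≤ W) :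
    registerFn n k L p N ∈ kOBDD n k W := by
  refine mem_kOBDD_of_machine hkn (fun _ => false, false, true) (fun _ => false, false, true)
    (fun _ => false, true, true) (by simp)
    (fun j b st => (layerInstr L p N (j % n)).run (j / n) b st) (fun st => st.2.1) _
    (fun x => rfl) ?_
  simpa using hW

/-- The sign that corresponds to a bit. -/
def bitSign (b : Bool) : ℝ := if b then -1 else 1

theorem bitSign_xor (a b : Bool) : bitSign (a ^^ b) = bitSign a * bitSign b := by
  cases a <;> cases b <;> simp [bitSign]

variable (τ : ℕ → BlockTask p) (v : ℕ → Bool) (t lo c : ℕ)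

theorem effect_reads (h : ∀ i < c, (τ (lo + i)).layer = t → (τ (lo + i)).read = true)
    (r : Fin p → Bool) (s : Bool) :
    ∃ s', applySeq (fun i => (τ (lo + i)).effect t (v (lo + i))) c (r, s) = (r, s') ∧
      bitSign s' = bitSign s * ∏ i ∈ Finset.range c,
        if (τ (lo + i)).layer = t then bitSign (v (lo + i) && r (τ (lo + i)).reg) else 1 := by
  induction c with
  | zero => exact ⟨s, rfl, by simp⟩
  | succ c ih =>
    obtain ⟨s', h1, h2⟩ := ih fun i hi => h i (by omega)
    rw [applySeq, h1, Finset.prod_range_succ, ← mul_assoc, ← h2]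
    by_cases hl : (τ (lo + c)).layer = t
    · exact ⟨s' ^^ (v (lo + c) && r (τ (lo + c)).reg),
        by simp [BlockTask.effect, hl, h c (by omega) hl], by simp [hl, bitSign_xor]⟩
    · exact ⟨s', by simp [BlockTask.effect, hl], by simp [hl]⟩

/-- Idle blocks are encoded as reads with value `false`, hence they are harmless here. Prescribing
values by register through `z` makes the order of the writes immaterial. -/
theorem effect_writes (z : Fin p → Bool)
    (h : ∀ i < c, (τ (lo + i)).layer = t → ((τ (lo + i)).read = true ∧ v (lo + i) = false) ∨
      ((τ (lo + i)).read = false ∧ v (lo + i) = z (τ (lo + i)).reg))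
    (r : Fin p → Bool) (s : Bool) :
    ∃ r', applySeq (fun i => (τ (lo + i)).effect t (v (lo + i))) c (r, s) = (r', s) ∧
      ∀ j, (∃ i < c, (τ (lo + i)).layer = t ∧ (τ (lo + i)).read = false ∧
        (τ (lo + i)).reg = j) → r' j = z j := by
  induction c with
  | zero => exact ⟨r, rfl, fun j => by simp⟩
  | succ c ih =>
    obtain ⟨r', h1, h2⟩ := ih fun i hi => h i (by omega)
    rw [applySeq, h1]
    by_cases hl : (τ (lo + c)).layer = t
    · rcases h c (by omega) hl with ⟨hr, hv⟩ | ⟨hr, hv⟩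
      · refine ⟨r', by simp [BlockTask.effect, hl, hr, hv], fun j => ?_⟩
        rintro ⟨i, hi, hi1, hi2, hi3⟩
        refine h2 j ⟨i, lt_of_le_of_ne (by omega) ?_, hi1, hi2, hi3⟩
        rintro rfl
        rw [hr] at hi2
        cases hi2
      · refine ⟨Function.update r' (τ (lo + c)).reg (z (τ (lo + c)).reg),
          by simp [BlockTask.effect, hl, hr, hv], fun j => ?_⟩
        by_cases hj : j = (τ (lo + c)).reg
        · subst hj
          simp
        · rw [Function.update_of_ne hj]
          rintro ⟨i, hi, hi1, hi2, hi3⟩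
          refine h2 j ⟨i, lt_of_le_of_ne (by omega) ?_, hi1, hi2, hi3⟩
          rintro rfl
          exact hj hi3.symm
    · refine ⟨r', by simp [BlockTask.effect, hl], fun j => ?_⟩
      rintro ⟨i, hi, hi1, hi2, hi3⟩
      refine h2 j ⟨i, lt_of_le_of_ne (by omega) ?_, hi1, hi2, hi3⟩
      rintro rfl
      exact hl hi1

theorem prod_range_eq_prod_of_injective {ι : Type*} [Fintype ι] {f : ℕ → ℝ} {lo c : ℕ} {ρ : ι → ℕ}
    (hρ : Function.Injective ρ) (hmem : ∀ j, lo ≤ ρ j ∧ ρ j < lo + c)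
    (h1 : ∀ i, lo ≤ i → i < lo + c → (∀ j, ρ j ≠ i) → f i = 1) :
    ∏ i ∈ Finset.range c, f (lo + i) = ∏ j, f (ρ j) := by
  classical
  have h2 := Finset.prod_Ico_eq_prod_range f lo (lo + c)
  rw [Nat.add_sub_cancel_left] at h2
  rw [← h2, ← Finset.prod_image (s := Finset.univ) (g := ρ) (fun i _ j _ h => hρ h)]
  symm
  refine Finset.prod_subset ?_ ?_
  · intro i hi
    obtain ⟨j, -, rfl⟩ := Finset.mem_image.1 hi
    exact Finset.mem_Ico.2 (hmem j)
  · intro i hi hn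
    rw [Finset.mem_Ico] at hi
    exact h1 i hi.1 hi.2 fun j hj => hn (Finset.mem_image.2 ⟨j, Finset.mem_univ _, hj⟩)

end RegisterFunction

/-! ### Choosing blocks and a cut -/

section Threshold

theorem exists_card_filter_lt_eq (S : Finset ℕ) (a : ℕ) (ha : a ≤ S.card) :
    ∃ c, (S.filter (· < c)).card = a := by
  induction a with
  | zero => exact ⟨0, by simp⟩
  | succ a ih =>
    obtain ⟨c, hc⟩ := ih (by omega)
    have hne : (S.filter (c ≤ ·)).Nonempty := by
      rw [← Finset.card_pos]
      have := Finset.card_filter_add_card_filter_not (s := S) (· < c)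
      simp only [not_lt] at this
      omega
    set m := (S.filter (c ≤ ·)).min' hne with hm
    have hmS := Finset.mem_filter.1 ((S.filter (c ≤ ·)).min'_mem hne)
    refine ⟨m + 1, ?_⟩
    have : S.filter (· < m + 1) = insert m (S.filter (· < c)) := by
      ext i
      simp only [Finset.mem_filter, Finset.mem_insert]
      constructor
      · rintro ⟨h1, h2⟩
        by_cases hi : c ≤ i
        · left
          have := (S.filter (c ≤ ·)).min'_le i (Finset.mem_filter.2 ⟨h1, hi⟩)
          omega
        · exact Or.inr ⟨h1, by omega⟩
      · rintro (rfl | ⟨h1, h2⟩)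
        · exact ⟨hmS.1, by omega⟩
        · have : c ≤ m := hmS.2
          exact ⟨h1, by omega⟩
    rw [this, Finset.card_insert_of_notMem, hc]
    intro h
    have h1 := (Finset.mem_filter.1 h).2
    have h2 : c ≤ m := hmS.2
    omega

theorem exists_injective_mem {ι : Type*} [Fintype ι] {S : Finset ℕ} (h : Fintype.card ι ≤ S.card) :
    ∃ ρ : ι → ℕ, Function.Injective ρ ∧ ∀ i, ρ i ∈ S := by
  obtain ⟨e⟩ := Function.Embedding.nonempty_of_card_le (α := ι) (β := S) (by simpa using h)
  exact ⟨fun i => e i, Subtype.val_injective.comp e.injective, fun i => (e i).2⟩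

theorem exists_injective_lt_threshold {ι κ : Type*} [Fintype ι] [Fintype κ] {S : Finset ℕ}
    (h : Fintype.card ι + Fintype.card κ ≤ S.card) :
    ∃ (B : ℕ) (ρ : ι → ℕ) (σ : κ → ℕ), Function.Injective ρ ∧ Function.Injective σ ∧
      (∀ i, ρ i ∈ S ∧ ρ i < B) ∧ ∀ i, σ i ∈ S ∧ B ≤ σ i := by
  obtain ⟨B, hB⟩ := exists_card_filter_lt_eq S (Fintype.card ι) (by omega)
  have := Finset.card_filter_add_card_filter_not (s := S) (· < B)
  obtain ⟨ρ, hρ, hρS⟩ := exists_injective_mem (ι := ι) (S := S.filter (· < B)) (by omega)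
  obtain ⟨σ, hσ, hσS⟩ := exists_injective_mem (ι := κ) (S := S.filter (¬ · < B)) (by omega)
  exact ⟨B, ρ, σ, hρ, hσ, fun i => Finset.mem_filter.1 (hρS i),
    fun i => by simpa using Finset.mem_filter.1 (hσS i)⟩

/-- Cut at the median of the positions of the first `2 * m` blocks. Of the other `2 * m` blocks at
least `m` lie on one side; pair these with the `m` first blocks on the opposite side. -/
theorem exists_cut {m : ℕ} {pos : ℕ → ℕ} (hpos : Set.InjOn pos (Finset.range (2 * m + 2 * m))) :
    ∃ (c : ℕ) (F G : Finset ℕ), (∀ b ∈ F, b < 2 * m) ∧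
      (∀ b ∈ G, 2 * m ≤ b ∧ b < 2 * m + 2 * m) ∧ m ≤ F.card ∧ m ≤ G.card ∧
      (((∀ b ∈ F, pos b < c) ∧ ∀ b ∈ G, c ≤ pos b) ∨
        ((∀ b ∈ F, c ≤ pos b) ∧ ∀ b ∈ G, pos b < c)) := by
  classical
  have hinj : Set.InjOn pos (Finset.range (2 * m)) :=
    hpos.mono (by intro x hx; simp at hx ⊢; omega)
  have hcard : ((Finset.range (2 * m)).image pos).card = 2 * m := by
    rw [Finset.card_image_of_injOn hinj, Finset.card_range]
  obtain ⟨c, hc⟩ := exists_card_filter_lt_eq ((Finset.range (2 * m)).image pos) m (by omega)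
  rw [Finset.filter_image, Finset.card_image_of_injOn (hinj.mono fun x hx => by
    simp at hx ⊢; exact hx.1)] at hc
  have h1 := Finset.card_filter_add_card_filter_not (s := Finset.range (2 * m)) (pos · < c)
  have h2 := Finset.card_filter_add_card_filter_not (s := Finset.Ico (2 * m) (2 * m + 2 * m))
    (pos · < c)
  rw [Finset.card_range] at h1
  rw [Nat.card_Ico] at h2
  by_cases h : m ≤ ((Finset.Ico (2 * m) (2 * m + 2 * m)).filter (pos · < c)).card
  · refine ⟨c, (Finset.range (2 * m)).filter (¬ pos · < c), _, ?_, ?_, by omega, h, Or.inr ⟨?_, ?_⟩⟩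
    all_goals intro b hb; simp at hb; omega
  · refine ⟨c, (Finset.range (2 * m)).filter (pos · < c),
      (Finset.Ico (2 * m) (2 * m + 2 * m)).filter (¬ pos · < c), ?_, ?_, by omega, by omega,
      Or.inl ⟨?_, ?_⟩⟩
    all_goals intro b hb; simp at hb; omega

end Threshold

/-! ### Two players computing an inner product -/

section Chain
variable {K p : ℕ}

/-- The places of the bits exchanged by two players who send `K + 1` messages, respectively `K`
messages, of `p` bits. -/
abbrev ChainIndex (K p : ℕ) : Type := (Fin (K + 1) × Fin p) ⊕ (Fin K × Fin p)

theorem card_chainIndex (K p : ℕ) : Fintype.card (ChainIndex K p) = (2 * K + 1) * p := by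
  simp; ring

/-- The tasks of the blocks of the first player: he writes in every layer, and then reads the answer
in the next layer. -/
def firstTask : ChainIndex K p → BlockTask p
  | .inl (t, j) => ⟨t, j, false⟩
  | .inr (t, j) => ⟨t + 1, j, true⟩

/-- The tasks of the blocks of the second player: he reads and then writes an answer. -/
def secondTask : ChainIndex K p → BlockTask p
  | .inl (t, j) => ⟨t, j, true⟩
  | .inr (t, j) => ⟨t, j, false⟩

/-- The blocks `ρ q` of the first player and `σ q` of the second player have their tasks and values,
and the other blocks have no effect. -/
structure IsChainInput (ρ σ : ChainIndex K p → ℕ) (a b : ChainIndex K p → Bool) (τ : ℕ → BlockTask p)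
    (v : ℕ → Bool) : Prop where
  first_task : ∀ q, τ (ρ q) = firstTask q
  first_value : ∀ q, v (ρ q) = a q
  second_task : ∀ q, τ (σ q) = secondTask q
  second_value : ∀ q, v (σ q) = b q
  idle : ∀ i, (∀ q, ρ q ≠ i) → (∀ q, σ q ≠ i) → (τ i).read = true ∧ v i = false

/-- The blocks are in the order in which the players need them in a layer. -/
structure IsChainOrdered (ρ σ : ChainIndex K p → ℕ) (c₁ c₂ c₃ c₄ : ℕ) : Prop where
  first_inr : ∀ q, ρ (.inr q) < c₁
  first_inl : ∀ q, c₁ ≤ ρ (.inl q) ∧ ρ (.inl q) < c₁ + c₂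
  second_inl : ∀ q, c₁ + c₂ ≤ σ (.inl q) ∧ σ (.inl q) < c₁ + c₂ + c₃
  second_inr : ∀ q, c₁ + c₂ + c₃ ≤ σ (.inr q) ∧ σ (.inr q) < c₁ + c₂ + c₃ + c₄

variable {ρ σ : ChainIndex K p → ℕ} {a b : ChainIndex K p → Bool} {τ : ℕ → BlockTask p}
  {v : ℕ → Bool} {c₁ c₂ c₃ c₄ : ℕ}

theorem IsChainInput.cases (h : IsChainInput ρ σ a b τ v) (i : ℕ) :
    (∃ q, i = ρ (.inl q)) ∨ (∃ q, i = ρ (.inr q)) ∨ (∃ q, i = σ (.inl q)) ∨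
      (∃ q, i = σ (.inr q)) ∨ ((τ i).read = true ∧ v i = false) := by
  by_cases h1 : ∃ q, ρ q = i
  · obtain ⟨q | q, rfl⟩ := h1
    · exact Or.inl ⟨q, rfl⟩
    · exact Or.inr (Or.inl ⟨q, rfl⟩)
  by_cases h2 : ∃ q, σ q = i
  · obtain ⟨q | q, rfl⟩ := h2
    · exact Or.inr (Or.inr (Or.inl ⟨q, rfl⟩))
    · exact Or.inr (Or.inr (Or.inr (Or.inl ⟨q, rfl⟩)))
  · push Not at h1 h2
    exact Or.inr (Or.inr (Or.inr (Or.inr (h.idle i h1 h2))))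

/-- One layer is a round: the first player multiplies the answer left in the registers by his bits
(factor `P`) and writes a message, the second multiplies that message by his bits and writes an
answer. -/
theorem IsChainInput.layer (h : IsChainInput ρ σ a b τ v) (ho : IsChainOrdered ρ σ c₁ c₂ c₃ c₄)
    (hρ : Function.Injective ρ) (hσ : Function.Injective σ) (t : ℕ) (ht : t < K + 1)
    (r : Fin p → Bool) (s : Bool) :
    ∃ r' s' P, applySeq (fun i => (τ i).effect t (v i)) (c₁ + c₂ + c₃ + c₄) (r, s) = (r', s') ∧
      (∀ (htK : t < K) j, r' j = b (.inr (⟨t, htK⟩, j))) ∧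
      bitSign s' = bitSign s * P *
        ∏ j, bitSign (a (.inl (⟨t, ht⟩, j)) && b (.inl (⟨t, ht⟩, j))) ∧
      (t = 0 → P = 1) ∧ ∀ (t₀ : ℕ) (h₀ : t₀ < K), t = t₀ + 1 →
        P = ∏ j, bitSign (a (.inr (⟨t₀, h₀⟩, j)) && r j) := by
  have hcase : ∀ i, _ := h.cases
  -- the reads of the first player
  obtain ⟨s₁, hs₁, hP₁⟩ := effect_reads τ v t 0 c₁ (by
    intro i hi _
    rw [zero_add]
    rcases hcase i with ⟨q, rfl⟩ | ⟨q, rfl⟩ | ⟨q, rfl⟩ | ⟨q, rfl⟩ | hi'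
    · have := ho.first_inl q; omega
    · rw [h.first_task]; rfl
    · have := ho.second_inl q; omega
    · have := ho.second_inr q; omega
    · exact hi'.1) r s
  simp only [zero_add] at hs₁ hP₁
  -- the writes of the first player
  obtain ⟨r₂, hs₂, hr₂⟩ := effect_writes τ v t c₁ c₂ (fun j => a (.inl (⟨t, ht⟩, j))) (by
    intro i hi hl
    rcases hcase (c₁ + i) with ⟨q, hq⟩ | ⟨q, hq⟩ | ⟨q, hq⟩ | ⟨q, hq⟩ | hi'
    · right
      rw [hq, h.first_task, h.first_value]
      rw [hq, h.first_task] at hl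
      obtain ⟨⟨t', ht'⟩, j⟩ := q
      obtain rfl : t' = t := hl
      exact ⟨rfl, rfl⟩
    · have := ho.first_inr q; omega
    · have := ho.second_inl q; omega
    · have := ho.second_inr q; omega
    · exact Or.inl hi') r s₁
  have hr₂' : r₂ = fun j => a (.inl (⟨t, ht⟩, j)) := by
    funext j
    have h1 := ho.first_inl (⟨t, ht⟩, j)
    refine hr₂ j ⟨ρ (.inl (⟨t, ht⟩, j)) - c₁, by omega, ?_⟩
    rw [Nat.add_sub_cancel' h1.1, h.first_task]
    exact ⟨rfl, rfl, rfl⟩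
  -- the reads of the second player
  obtain ⟨s₃, hs₃, hP₃⟩ := effect_reads τ v t (c₁ + c₂) c₃ (by
    intro i hi _
    rcases hcase (c₁ + c₂ + i) with ⟨q, hq⟩ | ⟨q, hq⟩ | ⟨q, hq⟩ | ⟨q, hq⟩ | hi'
    · have := ho.first_inl q; omega
    · have := ho.first_inr q; omega
    · rw [hq, h.second_task]; rfl
    · have := ho.second_inr q; omega
    · exact hi'.1) r₂ s₁
  -- the writes of the second player
  obtain ⟨r₄, hs₄, hr₄⟩ := effect_writes τ v t (c₁ + c₂ + c₃) c₄
    -- In the last layer there is no answer, and the value `false` is never used.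
    (fun j => if htK : t < K then b (.inr (⟨t, htK⟩, j)) else false) (by
    intro i hi hl
    rcases hcase (c₁ + c₂ + c₃ + i) with ⟨q, hq⟩ | ⟨q, hq⟩ | ⟨q, hq⟩ | ⟨q, hq⟩ | hi'
    · have := ho.first_inl q; omega
    · have := ho.first_inr q; omega
    · have := ho.second_inl q; omega
    · right
      rw [hq, h.second_task, h.second_value]
      rw [hq, h.second_task] at hl
      obtain ⟨⟨t', ht'⟩, j⟩ := q
      obtain rfl : t' = t := hl
      exact ⟨rfl, by simp [ht', secondTask]⟩
    · exact Or.inl hi') r₂ s₃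
  refine ⟨r₄, s₃, ∏ i ∈ Finset.range c₁,
    if (τ i).layer = t then bitSign (v i && r (τ i).reg) else 1, ?_, ?_, ?_, ?_, ?_⟩
  · rw [applySeq_add, applySeq_add, applySeq_add, hs₁, hs₂, hs₃, hs₄]
  · intro htK j
    have h1 := ho.second_inr (⟨t, htK⟩, j)
    refine (hr₄ j ⟨σ (.inr (⟨t, htK⟩, j)) - (c₁ + c₂ + c₃), by omega, ?_⟩).trans
      (dif_pos htK)
    rw [Nat.add_sub_cancel' h1.1, h.second_task]
    exact ⟨rfl, rfl, rfl⟩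
  · rw [hP₃, hP₁]
    congr 1
    rw [prod_range_eq_prod_of_injective (ρ := fun j => σ (.inl (⟨t, ht⟩, j)))
      (f := fun i => if (τ i).layer = t then bitSign (v i && r₂ (τ i).reg) else 1)]
    · refine Finset.prod_congr rfl fun j _ => ?_
      rw [h.second_task, h.second_value, hr₂']
      exact (if_pos rfl).trans (congrArg bitSign (Bool.and_comm _ _))
    · intro j j' hj
      simpa using hσ hj
    · exact fun j => ho.second_inl _
    · intro i hi1 hi2 hi
      rcases hcase i with ⟨q, hq⟩ | ⟨q, hq⟩ | ⟨q, rfl⟩ | ⟨q, hq⟩ | hi'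
      · have := ho.first_inl q; omega
      · have := ho.first_inr q; omega
      · rw [h.second_task, if_neg]
        intro hl
        obtain ⟨⟨t', ht'⟩, j⟩ := q
        obtain rfl : t' = t := hl
        exact hi j rfl
      · have := ho.second_inr q; omega
      · simp [hi'.2, bitSign]
  · rintro rfl
    refine Finset.prod_eq_one fun i hi => ?_
    rw [Finset.mem_range] at hi
    rcases hcase i with ⟨q, hq⟩ | ⟨q, rfl⟩ | ⟨q, hq⟩ | ⟨q, hq⟩ | hi'
    · have := ho.first_inl q; omega
    · rw [h.first_task, if_neg]
      exact Nat.succ_ne_zero _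
    · have := ho.second_inl q; omega
    · have := ho.second_inr q; omega
    · simp [hi'.2, bitSign]
  · rintro t₀ h₀ rfl
    have h0 := prod_range_eq_prod_of_injective (ρ := fun j => ρ (.inr (⟨t₀, h₀⟩, j))) (lo := 0)
      (c := c₁)
      (f := fun i => if (τ i).layer = t₀ + 1 then bitSign (v i && r (τ i).reg) else 1) ?_ ?_ ?_
    · simp only [zero_add] at h0
      rw [h0]
      refine Finset.prod_congr rfl fun j _ => ?_
      rw [h.first_task, h.first_value]
      exact if_pos rfl
    · intro j j' hj
      simpa using hρ hj
    · exact fun j => ⟨Nat.zero_le _, by rw [zero_add]; exact ho.first_inr _⟩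
    · intro i hi1 hi2 hi
      rcases hcase i with ⟨q, hq⟩ | ⟨q, rfl⟩ | ⟨q, hq⟩ | ⟨q, hq⟩ | hi'
      · have := ho.first_inl q; omega
      · rw [h.first_task, if_neg]
        intro hl
        obtain ⟨⟨t', ht'⟩, j⟩ := q
        obtain rfl : t' = t₀ := Nat.succ_injective hl
        exact hi j rfl
      · have := ho.second_inl q; omega
      · have := ho.second_inr q; omega
      · simp [hi'.2, bitSign]

theorem IsChainInput.bitSign_eq (h : IsChainInput ρ σ a b τ v) (ho : IsChainOrdered ρ σ c₁ c₂ c₃ c₄)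
    (hρ : Function.Injective ρ) (hσ : Function.Injective σ) :
    bitSign (applySeq (fun t => applySeq (fun i => (τ i).effect t (v i)) (c₁ + c₂ + c₃ + c₄))
      (K + 1) (fun _ => false, false)).2 = ∏ q, bitSign (a q && b q) := by
  set w₁ : ℕ → ℝ := fun t =>
    if ht : t < K + 1 then ∏ j, bitSign (a (.inl (⟨t, ht⟩, j)) && b (.inl (⟨t, ht⟩, j))) else 1
    with hw₁
  set w₂ : ℕ → ℝ := fun t =>
    if ht : t < K then ∏ j, bitSign (a (.inr (⟨t, ht⟩, j)) && b (.inr (⟨t, ht⟩, j))) else 1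
    with hw₂
  have key : ∀ t, t < K + 1 → ∃ r s, applySeq (fun t => applySeq
      (fun i => (τ i).effect t (v i)) (c₁ + c₂ + c₃ + c₄)) (t + 1) (fun _ => false, false) = (r, s) ∧
      (∀ (htK : t < K) j, r j = b (.inr (⟨t, htK⟩, j))) ∧
      bitSign s = (∏ i ∈ Finset.range (t + 1), w₁ i) * ∏ i ∈ Finset.range t, w₂ i := by
    intro t
    induction t with
    | zero =>
      intro ht
      obtain ⟨r, s, P, h1, h2, h3, h4, -⟩ := h.layer ho hρ hσ 0 ht (fun _ => false) false
      refine ⟨r, s, h1, h2, ?_⟩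
      have e0 : bitSign false = 1 := by simp [bitSign]
      have e1 : w₁ 0 =
          ∏ j, bitSign (a (.inl (⟨0, ht⟩, j)) && b (.inl (⟨0, ht⟩, j))) := dif_pos ht
      rw [h3, h4 rfl, e0, zero_add, Finset.prod_range_one, Finset.prod_range_zero, e1, mul_one,
        one_mul, mul_one]
    | succ t ih =>
      intro ht
      obtain ⟨r, s, h1, h2, h3⟩ := ih (by omega)
      obtain ⟨r', s', P, h1', h2', h3', -, h5'⟩ := h.layer ho hρ hσ (t + 1) ht r s
      refine ⟨r', s', by rw [applySeq, h1, h1'], h2', ?_⟩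
      have htK : t < K := by omega
      rw [h3', h3, h5' t htK rfl, Finset.prod_range_succ w₁ (t + 1), Finset.prod_range_succ w₂ t]
      have e1 : w₁ (t + 1) =
          ∏ j, bitSign (a (.inl (⟨t + 1, ht⟩, j)) && b (.inl (⟨t + 1, ht⟩, j))) := dif_pos ht
      have e2 : w₂ t = ∏ j, bitSign (a (.inr (⟨t, htK⟩, j)) && r j) := by
        simp only [hw₂, dif_pos htK, h2 htK]
      rw [e1, e2]
      ring
  obtain ⟨r, s, h1, -, h3⟩ := key K (by omega)
  rw [h1, h3, Fintype.prod_sum_type, Fintype.prod_prod_type, Fintype.prod_prod_type,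
    Finset.prod_range, Finset.prod_range]
  congr 1
  · exact Finset.prod_congr rfl fun t _ => dif_pos t.2
  · exact Finset.prod_congr rfl fun t _ => dif_pos t.2

/-- The sum factors over the coordinates, and a coordinate where `a` and `a'` differ contributes `1
+ (-1)`. -/
theorem sum_prod_bitSign_eq_zero {Q : Type*} [Fintype Q] [DecidableEq Q] {a a' : Q → Bool}
    (h : a ≠ a') :
    ∑ b : Q → Bool, (∏ q, bitSign (a q && b q)) * ∏ q, bitSign (a' q && b q) = 0 := by
  obtain ⟨q, hq⟩ := Function.ne_iff.1 h
  simp only [← Finset.prod_mul_distrib]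
  have := Finset.prod_univ_sum (fun _ : Q => (Finset.univ : Finset Bool))
    fun q c => bitSign (a q && c) * bitSign (a' q && c)
  rw [Fintype.piFinset_univ] at this
  rw [← this]
  refine Finset.prod_eq_zero (Finset.mem_univ q) ?_
  revert hq
  cases a q <;> cases a' q <;> simp [bitSign]

/-- In every order of the variables the register function contains an inner product. -/
theorem splitsHard_registerFn {n L m : ℕ} (hp : 0 < p) (hK : K + 1 ≤ 2 ^ L)
    (hm : m = (2 * K + 1) * p) (hn : (2 * m + 2 * m) * (L + 3 * p + 2) ≤ n) :
    SplitsHard (registerFn n (K + 1) L p (2 * m + 2 * m)) (2 ^ m) := by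
  classical
  intro π
  set N := 2 * m + 2 * m with hN
  set len := L + 3 * p + 2 with hlen
  have hm0 : 0 < m := by rw [hm]; positivity
  have hslot : ∀ i < N, i * len + (L + p) < n := by
    intro i hi
    have : (i + 1) * len ≤ N * len := Nat.mul_le_mul_right _ hi
    rw [Nat.succ_mul] at this
    omega
  have hn0 : 0 < n := by have := hslot 0 (by omega); omega
  -- The place in the order `π` where the value of block `i` is tested.
  set pos : ℕ → ℕ := fun i =>
    if h : i * len + (L + p) < n then (π.symm ⟨i * len + (L + p), h⟩ : ℕ) else 0 with hpos
  have hposinj : Set.InjOn pos (Finset.range N) := by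
    intro i hi i' hi' h
    simp only [Finset.coe_range, Set.mem_Iio] at hi hi'
    simp only [hpos, dif_pos (hslot i hi), dif_pos (hslot i' hi')] at h
    have h1 := π.symm.injective (Fin.ext h)
    have h2 : i * len = i' * len := by simpa using h1
    exact Nat.eq_of_mul_eq_mul_right (by omega) h2
  obtain ⟨c, F, G, hF, hG, hFc, hGc, hside⟩ := exists_cut hposinj
  have hc1 : Fintype.card (Fin K × Fin p) + Fintype.card (Fin (K + 1) × Fin p) = m := by
    rw [hm]; simp; ring
  -- The lower blocks of `F` serve as reads: the first player must use the answer of the previous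
  -- layer before he overwrites it. In `G` too, reads precede writes.
  obtain ⟨B, ρr, ρl, hρr, hρl, hρrF, hρlF⟩ := exists_injective_lt_threshold (ι := Fin K × Fin p)
    (κ := Fin (K + 1) × Fin p) (S := F) (by omega)
  obtain ⟨B', σl, σr, hσl, hσr, hσlG, hσrG⟩ := exists_injective_lt_threshold
    (ι := Fin (K + 1) × Fin p) (κ := Fin K × Fin p) (S := G) (by omega)
  set ρ : ChainIndex K p → ℕ := Sum.elim ρl ρr with hρ
  set σ : ChainIndex K p → ℕ := Sum.elim σl σr with hσ
  have hρF : ∀ q, ρ q ∈ F := by rintro (q | q); exacts [(hρlF q).1, (hρrF q).1]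
  have hσG : ∀ q, σ q ∈ G := by rintro (q | q); exacts [(hσlG q).1, (hσrG q).1]
  have hρi : Function.Injective ρ := by
    refine Function.Injective.sumElim hρl hρr fun q q' h => ?_
    have := (hρlF q).2
    have := (hρrF q').2
    omega
  have hσi : Function.Injective σ := by
    refine Function.Injective.sumElim hσl hσr fun q q' h => ?_
    have := (hσlG q).2
    have := (hσrG q').2
    omega
  have hρσ : ∀ q q', ρ q ≠ σ q' := by
    intro q q' h
    have h1 := hF _ (hρF q)
    have h2 := hG _ (hσG q')
    omega
  have hinj : Function.Injective (Sum.elim ρ σ) := Function.Injective.sumElim hρi hσi hρσ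
  let q₀ : Fin (K + 1) × Fin p := (0, ⟨0, hp⟩)
  have hBm : B ≤ 2 * m := by
    have h1 := hF _ (hρlF q₀).1
    have h2 := (hρlF q₀).2
    omega
  have hB'm : 2 * m ≤ B' := by
    have h1 := hG _ (hσlG q₀).1
    have h2 := (hσlG q₀).2
    omega
  -- For `K = 0` there is no block above the threshold that would keep `B'` below `N`.
  set C := min B' N with hC
  have hCm : 2 * m ≤ C := by omega
  have ho : IsChainOrdered ρ σ B (2 * m - B) (C - 2 * m) (N - C) := by
    refine ⟨fun q => (hρrF q).2, fun q => ?_, fun q => ?_, fun q => ?_⟩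
    · have h1 := hF _ (hρlF q).1
      have h2 := (hρlF q).2
      change B ≤ ρl q ∧ ρl q < _
      omega
    · have h1 := hG _ (hσlG q).1
      have h2 := (hσlG q).2
      change _ ≤ σl q ∧ σl q < _
      omega
    · have h1 := hG _ (hσrG q).1
      have h2 := (hσrG q).2
      change _ ≤ σr q ∧ σr q < _
      omega
  have hsum : B + (2 * m - B) + (C - 2 * m) + (N - C) = N := by omega
  set τ : ℕ → BlockTask p := Function.extend (Sum.elim ρ σ) (Sum.elim firstTask secondTask)
    fun _ => ⟨0, ⟨0, hp⟩, true⟩ with hτ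
  set val : (ChainIndex K p → Bool) → (ChainIndex K p → Bool) → ℕ → Bool := fun a b =>
    Function.extend (Sum.elim ρ σ) (Sum.elim a b) fun _ => false with hval
  have hidle : ∀ i, (∀ q, ρ q ≠ i) → (∀ q, σ q ≠ i) → ¬ ∃ q, Sum.elim ρ σ q = i := by
    rintro i h1 h2 ⟨q | q, h⟩
    exacts [h1 q h, h2 q h]
  have hchain : ∀ a b, IsChainInput ρ σ a b τ (val a b) := by
    intro a b
    refine ⟨fun q => hinj.extend_apply _ _ (Sum.inl q), fun q => hinj.extend_apply _ _ (Sum.inl q),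
      fun q => hinj.extend_apply _ _ (Sum.inr q), fun q => hinj.extend_apply _ _ (Sum.inr q),
      fun i h1 h2 => ⟨?_, Function.extend_apply' _ _ _ (hidle i h1 h2)⟩⟩
    rw [hτ, Function.extend_apply' _ _ _ (hidle i h1 h2)]
  have hτlayer : ∀ i < N, (τ i).layer < 2 ^ L := by
    intro i _
    by_cases hex : ∃ q, Sum.elim ρ σ q = i
    · obtain ⟨q | q, rfl⟩ := hex
      · change (τ (ρ q)).layer < _
        rw [(hchain (fun _ => false) fun _ => false).first_task]
        rcases q with q | q
        · exact q.1.2.trans_le hK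
        · exact (Nat.succ_lt_succ q.1.2).trans_le hK
      · change (τ (σ q)).layer < _
        rw [(hchain (fun _ => false) fun _ => false).second_task]
        rcases q with q | q
        · exact q.1.2.trans_le hK
        · exact (q.1.2.trans (Nat.lt_succ_self K)).trans_le hK
    · rw [hτ, Function.extend_apply' _ _ _ hex]
      positivity
  set inp : (ChainIndex K p → Bool) → (ChainIndex K p → Bool) → Fin n → Bool := fun a b =>
    taskInput n L N τ (val a b) with hinp
  have hfn : ∀ a b, bitSign (registerFn n (K + 1) L p N (inp a b)) =
      ∏ q, bitSign (a q && b q) := by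
    intro a b
    rw [hinp, registerFn_taskInput hK hτlayer hn hn0, ← (hchain a b).bitSign_eq ho hρi hσi, hsum]
  have hsign : ∀ {X Y : Type} (f : X → Y → Fin n → Bool) x y,
      signMatrix (registerFn n (K + 1) L p N) f x y =
        bitSign (registerFn n (K + 1) L p N (f x y)) := fun f x y => rfl
  have hvala : ∀ a a' b i, (∀ q, ρ q ≠ i) → val a b i = val a' b i := by
    intro a a' b i hi
    by_cases hex : ∃ q, σ q = i
    · obtain ⟨q, rfl⟩ := hex
      rw [(hchain a b).second_value, (hchain a' b).second_value]
    · rw [((hchain a b).idle i hi fun q h => hex ⟨q, h⟩).2,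
        ((hchain a' b).idle i hi fun q h => hex ⟨q, h⟩).2]
  have hvalb : ∀ a b b' i, (∀ q, σ q ≠ i) → val a b i = val a b' i := by
    intro a b b' i hi
    by_cases hex : ∃ q, ρ q = i
    · obtain ⟨q, rfl⟩ := hex
      rw [(hchain a b).first_value, (hchain a b').first_value]
    · rw [((hchain a b).idle i (fun q h => hex ⟨q, h⟩) hi).2,
        ((hchain a b').idle i (fun q h => hex ⟨q, h⟩) hi).2]
  have hposeq : ∀ (i : Fin n) (j : ℕ), j < N → (π i : ℕ) = j * len + (L + p) → pos j = i := by
    intro i j hj h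
    simp only [hpos, dif_pos (hslot j hj)]
    have : (⟨j * len + (L + p), hslot j hj⟩ : Fin n) = π i := Fin.ext h.symm
    rw [this, Equiv.symm_apply_apply]
  have hposlt : ∀ j, pos j < n := by
    intro j
    simp only [hpos]
    split_ifs
    · exact Fin.is_lt _
    · exact hn0
  have hcard : Fintype.card (ChainIndex K p → Bool) = 2 ^ m := by
    rw [Fintype.card_fun, Fintype.card_bool, card_chainIndex, hm]
  have hind_a : ∀ i : Fin n, (∀ q, pos (ρ q) ≠ i) → ∀ a a' b, inp a b (π i) = inp a' b (π i) := by
    intro i hi a a' b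
    refine taskInput_congr fun j hj hij => hvala a a' b j ?_
    rintro q rfl
    exact hi q (hposeq i _ hj hij)
  have hind_b : ∀ i : Fin n, (∀ q, pos (σ q) ≠ i) → ∀ a b b', inp a b (π i) = inp a b' (π i) := by
    intro i hi a b b'
    refine taskInput_congr fun j hj hij => hvalb a b b' j ?_
    rintro q rfl
    exact hi q (hposeq i _ hj hij)
  rcases hside with ⟨h1, h2⟩ | ⟨h1, h2⟩
  · refine ⟨_, _, inferInstance, inferInstance, inferInstance, inferInstance, inp, c,
      (h2 _ (hσG (.inl q₀))).trans_lt (hposlt _), ⟨fun i hi => ?_, fun i hi => ?_⟩, hcard, ?_⟩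
    · refine hind_b i fun q hq => ?_
      have := h2 _ (hσG q)
      omega
    · intro a a' b
      refine hind_a i (fun q hq => ?_) a a' b
      have := h1 _ (hρF q)
      omega
    · intro x x' hx
      simp only [hsign, hfn]
      exact sum_prod_bitSign_eq_zero hx
  -- Here the blocks of the second player are tested first, so rows and columns change roles; the
  -- inner product is symmetric.
  · refine ⟨_, _, inferInstance, inferInstance, inferInstance, inferInstance, fun b a => inp a b, c,
      (h1 _ (hρF (.inl q₀))).trans_lt (hposlt _), ⟨fun i hi => ?_, fun i hi => ?_⟩, hcard, ?_⟩
    · intro b a a'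
      refine hind_a i (fun q hq => ?_) a a' b
      have := h1 _ (hρF q)
      omega
    · intro b b' a
      refine hind_b i (fun q hq => ?_) a b b'
      have := h2 _ (hσG q)
      omega
    · intro x x' hx
      simp only [hsign, hfn]
      simp only [Bool.and_comm _ (x _), Bool.and_comm _ (x' _)]
      exact sum_prod_bitSign_eq_zero hx

end Chain

/-! ### Numerical estimates and conclusion -/

section Main

/-- The slack `(3 / 2) ^ j ≥ 2` gives `2 * (d ^ j) ^ 2 ≤ q ^ j`, which absorbs the added 1 since `d
^ j ≥ 4` unless `d ≤ 1`. -/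
theorem add_one_sq_lt_pow {q d j : ℕ} (hj : 2 ≤ j) (hq : 32 ≤ q) (hd : 3 * d ^ 2 ≤ 2 * q) :
    (d ^ j + 1) ^ 2 < q ^ j := by
  rcases le_or_gt d 1 with h | h
  · have h1 : d ^ j ≤ 1 := pow_le_one' h j
    have h2 : q ^ 1 ≤ q ^ j := Nat.pow_le_pow_right (by omega) (by omega)
    have h3 := Nat.pow_le_pow_left (show d ^ j + 1 ≤ 2 by omega) 2
    rw [pow_one] at h2
    omega
  · have h3 : 2 * 2 ^ j ≤ 3 ^ j := by
      obtain ⟨i, rfl⟩ := Nat.exists_eq_add_of_le hj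
      have := Nat.pow_le_pow_left (show 2 ≤ 3 by omega) i
      rw [pow_add, pow_add]
      omega
    have h4 : 2 ^ 2 ≤ d ^ j := (Nat.pow_le_pow_left h 2).trans (Nat.pow_le_pow_right (by omega) hj)
    have h5 : 2 ^ j * (2 * (d ^ j) ^ 2) ≤ 2 ^ j * q ^ j := by
      calc 2 ^ j * (2 * (d ^ j) ^ 2) = (2 * 2 ^ j) * (d ^ j) ^ 2 := by ring
        _ ≤ 3 ^ j * (d ^ j) ^ 2 := Nat.mul_le_mul_right _ h3
        _ = (3 * d ^ 2) ^ j := by rw [mul_pow, ← pow_mul, ← pow_mul, mul_comm j]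
        _ ≤ (2 * q) ^ j := Nat.pow_le_pow_left hd j
        _ = 2 ^ j * q ^ j := mul_pow _ _ _
    have h6 := Nat.le_of_mul_le_mul_left h5 (by positivity)
    nlinarith

theorem pow_add_one_lt_pow {q d j : ℕ} (hj : 1 ≤ j) (hd : 2 * (d + 1) ≤ q) :
    d ^ j + 1 < q ^ j := by
  have h1 : d ^ j < (d + 1) ^ j := Nat.pow_lt_pow_left (Nat.lt_succ_self d) (by omega)
  have h2 : 2 ^ 1 ≤ 2 ^ j := Nat.pow_le_pow_right (by omega) hj
  have h3 := Nat.pow_le_pow_left hd j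
  have h4 := Nat.mul_le_mul_right ((d + 1) ^ j) h2
  rw [mul_pow] at h3
  omega

/-- The number of bits that are sent in a message. -/
theorem exists_messageLength {w : ℕ} (hw : 64 ≤ w) :
    ∃ p, 5 ≤ p ∧ 2 ^ p * 4 ≤ 3 * w + 1 ∧ 3 * w + 2 ≤ 2 ^ p * 8 := by
  have h1 : 7 ≤ Nat.log 2 (3 * w + 1) := Nat.le_log_of_pow_le (by omega) (by omega)
  have h2 := Nat.pow_log_le_self 2 (show 3 * w + 1 ≠ 0 by omega)
  have h3 := Nat.lt_pow_succ_log_self (show 1 < 2 by omega) (3 * w + 1)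
  obtain ⟨p, hp⟩ := Nat.exists_eq_add_of_le' (show 2 ≤ Nat.log 2 (3 * w + 1) by omega)
  rw [hp] at h1 h2 h3
  exact ⟨p, by omega, by rw [pow_add] at h2; omega, by rw [pow_succ, pow_add] at h3; omega⟩

theorem six_mul_le_two_pow {p : ℕ} (hp : 5 ≤ p) : 6 * p ≤ 2 ^ p := by
  induction p, hp using Nat.le_induction with
  | base => norm_num
  | succ p hp ih => rw [pow_succ]; omega

theorem four_mul_sq_le_of_le_sqrt {d w : ℕ} (h : (d : ℝ) ≤ Real.sqrt w / 2) : 4 * d ^ 2 ≤ w := by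
  have h1 : (2 * d : ℝ) ≤ Real.sqrt w := by linarith
  have h3 := pow_le_pow_left₀ (by positivity) h1 2
  rw [Real.sq_sqrt (Nat.cast_nonneg w)] at h3
  have h4 : ((4 * d ^ 2 : ℕ) : ℝ) ≤ w := by push_cast; linarith
  exact_mod_cast h4

theorem two_le_logb_mul_logb {k w : ℕ} (hk : 2 ≤ k) (hw : 64 ≤ w) :
    2 ≤ Real.logb 2 k * Real.logb 2 w := by
  have h1 : 1 ≤ Real.logb 2 k := by
    rw [Real.le_logb_iff_rpow_le one_lt_two (by positivity)]
    simpa using (by exact_mod_cast hk : (2 : ℝ) ≤ k)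
  have h2 : 2 ≤ Real.logb 2 w := by
    rw [Real.le_logb_iff_rpow_le one_lt_two (by positivity)]
    have : (64 : ℝ) ≤ w := by exact_mod_cast hw
    norm_num
    linarith
  nlinarith

end Main

theorem mainTheorem5 (n k w : ℕ) (hk : 2 ≤ k) (hw : 64 ≤ w)
    (hn : 2 * k * w * (2 * w + Nat.clog 2 k + Nat.clog 2 (2 * w)) < n)
    (hkw : 1 ≤ Real.sqrt w / (Real.logb 2 k * Real.logb 2 w)) :
    ∃ f : BoolFn n,
      (f ∈ kOBDD n k (3 * w + 1) ∧
        f ∈ kNOBDD n k (3 * w + 1) ∧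
        ∀ ε : ℝ, 0 < ε → ε ≤ 1 / 2 → f ∈ kPOBDD n k ε (3 * w + 1)) ∧
      (f ∉ kOBDD n k ((⌊(w : ℝ) / 16⌋ : ℝ) - 3) ∧
        f ∉ kNOBDD n k (Real.sqrt w / 2) ∧
        ∀ ε : ℝ, 0 < ε → ε ≤ 1 / 2 →
          f ∉ kPOBDD n k ε (Real.sqrt w / (Real.logb 2 k * Real.logb 2 w))) := by
  obtain ⟨p, hp, hp1, hp2⟩ := exists_messageLength hw
  obtain ⟨K, rfl⟩ : ∃ K, k = K + 1 := ⟨k - 1, by omega⟩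
  have hp6 := six_mul_le_two_pow hp
  have hq : 32 ≤ 2 ^ p := Nat.pow_le_pow_right (n := 2) (by omega) hp
  set L := Nat.clog 2 (K + 1) with hL
  set m := (2 * K + 1) * p with hm
  have hj : 2 * (K + 1) - 1 = 2 * K + 1 := by omega
  have hN : 2 ^ m = (2 ^ p) ^ (2 * K + 1) := by rw [← pow_mul, hm, mul_comm]
  have hlen : (2 * m + 2 * m) * (L + 3 * p + 2) ≤ n := by
    have h1 : 2 * m + 2 * m ≤ 2 * (K + 1) * w := by
      -- Here `4 * p ≤ w` comes from `6 * p ≤ 2 ^ p` and `2 ^ p * 4 ≤ 3 * w + 1`.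
      have : (2 * K + 1) * (4 * p) ≤ (2 * (K + 1)) * w := Nat.mul_le_mul (by omega) (by omega)
      rw [hm]
      linarith
    exact (Nat.mul_le_mul h1 (by omega)).trans hn.le
  have hhard := splitsHard_registerFn (n := n) (by omega : 0 < p)
    (Nat.le_pow_clog one_lt_two (K + 1)) hm hlen
  have hn0 : 0 < (K + 1) * n := Nat.mul_pos (Nat.succ_pos K) (by omega)
  have hdet : registerFn n (K + 1) L p (2 * m + 2 * m) ∈ kOBDD n (K + 1) (3 * w + 1) :=
    registerFn_mem_kOBDD hn0 (by exact_mod_cast hp1)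
  have hsmall : ∀ d : ℕ, (d : ℝ) ≤ Real.sqrt w / 2 →
      ¬ 2 ^ m ≤ (d ^ (2 * (K + 1) - 1) + 1) ^ 2 := by
    intro d hd
    have h1 := four_mul_sq_le_of_le_sqrt hd
    rw [hj, hN, not_le]
    -- From `4 * d ^ 2 ≤ w` and `3 * w + 2 ≤ 8 * 2 ^ p` follows `3 * d ^ 2 ≤ 2 * 2 ^ p`.
    exact add_one_sq_lt_pow (by omega) hq (by omega)
  refine ⟨_, ⟨hdet, kOBDD_subset_kNOBDD _ hdet, fun ε _ hε => kOBDD_subset_kPOBDD hε _ hdet⟩,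
    ?_, ?_, fun ε hε _ => ?_⟩
  · rintro ⟨P, hP, hf⟩
    have h1 := hhard.le_of_det (Nat.succ_pos K) le_rfl hf
    have h2 : 16 * P.width ≤ w := by
      have h3 := Int.floor_le ((w : ℝ) / 16)
      have h4 : ((16 * P.width : ℕ) : ℝ) ≤ w := by push_cast; linarith
      exact_mod_cast h4
    rw [hj, hN] at h1
    exact absurd h1 (pow_add_one_lt_pow (by omega) (by omega)).not_ge
  · rintro ⟨P, hP, hf⟩
    exact hsmall _ hP (hhard.le_of_nondet (Nat.succ_pos K) le_rfl hf)
  · rintro ⟨P, hP, hf⟩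
    refine hsmall _ (hP.trans ?_) (hhard.le_of_prob (Nat.succ_pos K) le_rfl hε hf)
    -- The product of the logarithms is at least 2, so this width is covered by the bound for
    -- `Real.sqrt w / 2`.
    exact div_le_div_of_nonneg_left (Real.sqrt_nonneg _) two_pos (two_le_logb_mul_logb hk hw)
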